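/- **Setting.** There are $K\ge 1$ arms and $1\le L\le K$. In rounds $t=1,2,\dots,T$ a forecaster selects a set $I(t)\subseteq[K]$ of $L$ arms and observes the rewards $x_i(t)$, $i\in I(t)$. An environment consists of reward vectors $(x_i(t))_{i\in[K]}\in[0,1]^K$, independent over $t$, with means $\mathbb E[x_i(t)]=\mu_{i,t}$; it is stationary if $\mu_{i,t}=\mu_i$ for all $t$. The regret is $$\mathrm{Reg}(S)=\sum_{t=1}^{S}\Big(\max_{|I|=L}\sum_{i\in I}\mu_{i,t}-\sum_{i\in I(t)}\mu_{i,t}\Big),\qquad \text{and}\quad \epsilon(t)=\sum_{1\le s<t}\max_{i}|\mu_{i,s}-\mu_{i,s+1}|$$ is the drift up to $t$. **Elimination-UCB** with horizon $T$. Let $k(t)=(t \bmod K)+1$ and let $W(t)=\{1,\dots,t-1\}$ be the window of past rounds. Let $N_i(t),\hat\mu_i(t)$ be the number of, and the mean reward over, the rounds $s\in W(t)$ with $i\in I(s)$; let $N_i^E(t),\hat\mu_i^E(t)$ be the same over the rounds $s\in W(t)$ with $i\in I(s)$ and $k(s)=i$. Put $B_i(t)=\sqrt{\log(T^4)/(2N_i(t))}$,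 $B_i^E(t)=\sqrt{\log(T^4)/(2N_i^E(t))}$ and $U_i(t)=\hat\mu_i(t)+B_i(t)$. An upper bound without samples is $+\infty$, a lower bound without samples is $-\infty$. Start with the candidate set $\hat I^*=[K]$. In round $t$, with $k=k(t)$: if $k\in\hat I^*$, then $I(t)$ consists of $k$ and $L-1$ arms of $[K]\setminus\{k\}$ with the largest $U_i(t)$; otherwise $I(t)$ consists of $L$ arms with the largest $U_i(t)$ (ties are broken by any rule that depends on $t$, the past selections and the current candidates). Then, if $|\hat I^*|\ge 2$ and some arm $i$ satisfies $\hat\mu_i^E(t)-B_i^E(t)>\hat\mu_k^E(t)+B_k^E(t)$, remove $k$ from $\hat I^*$. The *adaptive resetting bandit* (ADR) with confidence level $\delta\in(0,1)$ and base algorithm Elimination-UCB runs the same steps, but whenever, at the end of a round, for some arm $i$ the current window (including that round) splits into two consecutive parts that contain $n_1,n_2\ge1$ observations of arm $i$ with empirical means at distance at least $\sqrt{\log(1/\delta)/(2n_1)}+\sqrt{\log(1/\delta)/(2n_2)}$, it resets: the window becomes empty and $\hat I^*=[K]$. **Statement.** (A) *Monitoring consistency.* In every environment, and for every realization of the rewards,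 Elimination-UCB is monitoring consistent with parameter $K$: there is an arm that is drawn at least once in every $K$ consecutive rounds of $\{1,\dots,T\}$. The selections of ADR with base algorithm Elimination-UCB have the same property within every stretch of rounds between resets: for every round $b\le T$, if $a$ is the first round of the window in force in round $b$, there is an arm that is drawn at least once in every $K$ consecutive rounds of $\{a,\dots,b\}$. (B) *Logarithmic distribution-dependent regret.* There is a universal constant $C$ such that in every stationary environment with $L<K$ and $\Delta_{\min}=\mu_{(L)}-\mu_{(L+1)}>0$, where $\mu_{(1)}\ge\dots\ge\mu_{(K)}$ are the sorted means, Elimination-UCB satisfies $$\mathbb E[\mathrm{Reg}(T)]\le C\,\frac{K\log T}{\Delta_{\min}}+o(\log T)\qquad(T\to\infty),$$ where the $o(\log T)$ term depends only on $K$, $L$ and the means. (C) *Sublinear strong drift-tolerant regret.* There are universal constants $C$ and $p$ such that for all $K$, $L$, $T\ge1$ and every environment (with arbitrarily changing means), Elimination-UCB satisfies, with probability at least $1-4K/T^2$, simultaneously for all $S\in\{1,\dots,T\}$, $$\mathrm{Reg}(S)\le C(\log T)^p\sqrt{LKS}+C\,L\sum_{t=1}^{S}\epsilon(t).$$ -/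

import Mathlib

open MeasureTheory ProbabilityTheory Filter Asymptotics
open scoped BigOperators Classical

namespace ElimUCB

/-! ### Environments and regret.
Arms are indexed by `Fin K`; rounds are `t = 1, 2, …` (the values at `t = 0` play no role). -/

/-- A random environment with reward vectors `x t ω : Fin K → ℝ` and means `μ t i`. The reward
vectors of different rounds are independent (rewards of different arms in one round need not be). -/
structure IsEnvironment {K : ℕ} {Ω : Type*} [MeasurableSpace Ω] (P : Measure Ω)
    (x : ℕ → Ω → Fin K → ℝ) (μ : ℕ → Fin K → ℝ) : Prop where
  measurable : ∀ t, Measurable (x t)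
  mem_unit : ∀ t i, ∀ᵐ ω ∂P, x t ω i ∈ Set.Icc (0 : ℝ) 1
  mean : ∀ t i, ∫ ω, x t ω i ∂P = μ t i
  indep : iIndepFun x P

/-- Total mean of the best `L` arms in round `t`. -/
noncomputable def bestValue {K : ℕ} (L : ℕ) (μ : ℕ → Fin K → ℝ) (t : ℕ) : ℝ :=
  sSup {r | ∃ A : Finset (Fin K), A.card = L ∧ r = ∑ i ∈ A, μ t i}

/-- Regret of the selection sequence `I` in round `t`. -/
noncomputable def reg {K : ℕ} (L : ℕ) (μ : ℕ → Fin K → ℝ) (I : ℕ → Finset (Fin K)) (t : ℕ) : ℝ :=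
  bestValue L μ t - ∑ i ∈ I t, μ t i

/-- Cumulative regret over the rounds `1, …, S`. -/
noncomputable def Reg {K : ℕ} (L : ℕ) (μ : ℕ → Fin K → ℝ) (I : ℕ → Finset (Fin K)) (S : ℕ) : ℝ :=
  ∑ t ∈ Finset.Icc 1 S, reg L μ I t

/-- The maximum drift `ε(t) = ∑_{1 ≤ s < t} max_i |μ_{i,s} - μ_{i,s+1}|`. -/
noncomputable def drift {K : ℕ} (μ : ℕ → Fin K → ℝ) (t : ℕ) : ℝ :=
  ∑ s ∈ Finset.Ico 1 t, ⨆ i, |μ s i - μ (s + 1) i|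

/-- Monitoring consistency with parameter `D` over the rounds `a, …, b`: one fixed arm is drawn at
least once in every `D` consecutive rounds that lie in `{a, …, b}`. -/
def MonitoringConsistentOn {K : ℕ} (D a b : ℕ) (I : ℕ → Finset (Fin K)) : Prop :=
  ∃ i : Fin K, ∀ t ∈ Finset.Icc a (b + 1 - D), ∃ t' ∈ Finset.Icc t (t + D - 1), i ∈ I t'

/-- Monitoring consistency with parameter `D` over the horizon `1, …, T`. -/
def MonitoringConsistent {K : ℕ} (D T : ℕ) (I : ℕ → Finset (Fin K)) : Prop :=
  MonitoringConsistentOn D 1 T I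

/-! ### Statistics of a reward table `x : ℕ → Fin K → ℝ` under selections `I`, in a window `W`. -/

/-- The round-robin arm `(t mod K) + 1`; with arms numbered from `0` this is `t mod K`. -/
def arm (K : ℕ) [NeZero K] (t : ℕ) : Fin K := Fin.ofNat K t

/-- Rounds of `W` in which arm `i` is selected. -/
noncomputable def samples {K : ℕ} (I : ℕ → Finset (Fin K)) (W : Finset ℕ) (i : Fin K) :
    Finset ℕ :=
  W.filter fun s => i ∈ I s

/-- Rounds of `W` in which arm `i` is selected and has its round-robin turn. -/
noncomputable def samplesE {K : ℕ} [NeZero K] (I : ℕ → Finset (Fin K)) (W : Finset ℕ)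
    (i : Fin K) : Finset ℕ :=
  W.filter fun s => i ∈ I s ∧ i = arm K s

/-- Empirical mean of the rewards of arm `i` over a set `A` of rounds (used for `A ≠ ∅` only). -/
noncomputable def empMean {K : ℕ} (x : ℕ → Fin K → ℝ) (A : Finset ℕ) (i : Fin K) : ℝ :=
  (∑ s ∈ A, x s i) / A.card

/-- The confidence radius `√(log (T⁴) / (2 n))` of `n` samples (used for `n ≠ 0` only). -/
noncomputable def radius (T n : ℕ) : ℝ := √(Real.log ((T : ℝ) ^ 4) / (2 * n))

/-- Upper confidence bound computed from the rounds `A`; it is `+∞` without samples. -/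
noncomputable def upper {K : ℕ} (T : ℕ) (x : ℕ → Fin K → ℝ) (A : Finset ℕ) (i : Fin K) : EReal :=
  if A = ∅ then ⊤ else ((empMean x A i + radius T A.card : ℝ) : EReal)

/-- Lower confidence bound computed from the rounds `A`; it is `-∞` without samples. -/
noncomputable def lower {K : ℕ} (T : ℕ) (x : ℕ → Fin K → ℝ) (A : Finset ℕ) (i : Fin K) : EReal :=
  if A = ∅ then ⊥ else ((empMean x A i - radius T A.card : ℝ) : EReal)

/-- All sets of `m` arms of `avail` that are top-`m` in `avail` for the index `U`. -/
noncomputable def topSets {K : ℕ} (U : Fin K → EReal) (avail : Finset (Fin K)) (m : ℕ) :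
    Finset (Finset (Fin K)) :=
  (avail.powersetCard m).filter fun A => ∀ i ∈ A, ∀ j ∈ avail \ A, U j ≤ U i

/-! ### Elimination-UCB, possibly with resets. -/

/-- Internal state between two rounds: the first round `start` of the current window, the past
selections, and the candidates `cand` for the best arm. -/
structure State (K : ℕ) where
  start : ℕ
  sel : ℕ → Finset (Fin K)
  cand : Finset (Fin K)

/-- A tie-breaking rule: in round `t`, in a given state, it picks an element of a nonempty family
of sets of arms. -/
structure TieRule (K : ℕ) where
  pick : ℕ → State K → Finset (Finset (Fin K)) → Finset (Fin K)
  pick_mem : ∀ t σ F, F.Nonempty → pick t σ F ∈ F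

/-- A reset rule: given the reward table, the first round of the window, the current round `t` and
the selections up to `t`, it says whether a reset takes place at the end of round `t`. -/
abbrev ResetRule (K : ℕ) := (ℕ → Fin K → ℝ) → ℕ → ℕ → (ℕ → Finset (Fin K)) → Prop

/-- The base algorithm run alone: there are no resets. -/
def noReset (K : ℕ) : ResetRule K := fun _ _ _ _ => False

/-- The change detectors of the adaptive resetting bandit with confidence level `δ`: for some arm,
the window `{a, …, t}` splits into two parts (each with at least one observation of the arm) whose
empirical means differ by at least the threshold
`√(log (1/δ) / (2 n₁)) + √(log (1/δ) / (2 n₂))`. -/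
def adrReset (K : ℕ) (δ : ℝ) : ResetRule K := fun x a t I =>
  ∃ i : Fin K, ∃ m : ℕ, a < m ∧ m ≤ t ∧
    let A₁ := samples I (Finset.Ico a m) i
    let A₂ := samples I (Finset.Icc m t) i
    A₁ ≠ ∅ ∧ A₂ ≠ ∅ ∧
      √(Real.log (1 / δ) / (2 * A₁.card)) + √(Real.log (1 / δ) / (2 * A₂.card))
        ≤ |empMean x A₁ i - empMean x A₂ i|

section

variable {K : ℕ} [NeZero K] (L T : ℕ) (tie : TieRule K) (reset : ResetRule K)
  (x : ℕ → Fin K → ℝ)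

/-- The arms `I(t)` selected in round `t` from the state `σ` before round `t`. -/
noncomputable def select (t : ℕ) (σ : State K) : Finset (Fin K) :=
  let U : Fin K → EReal := fun i => upper T x (samples σ.sel (Finset.Ico σ.start t) i) i
  if arm K t ∈ σ.cand then
    insert (arm K t) (tie.pick t σ (topSets U (Finset.univ.erase (arm K t)) (L - 1)))
  else tie.pick t σ (topSets U Finset.univ L)

/-- The candidates after the elimination test of round `t`. -/
noncomputable def eliminate (t : ℕ) (σ : State K) : Finset (Fin K) :=
  let A : Fin K → Finset ℕ := fun i => samplesE σ.sel (Finset.Ico σ.start t) i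
  if 2 ≤ σ.cand.card ∧ ∃ i, upper T x (A (arm K t)) (arm K t) < lower T x (A i) i then
    σ.cand.erase (arm K t)
  else σ.cand

/-- The transition in round `t`. -/
noncomputable def step (t : ℕ) (σ : State K) : State K :=
  let sel' := Function.update σ.sel t (select L T tie x t σ)
  if reset x σ.start t sel' then
    { start := t + 1, sel := sel', cand := Finset.univ }
  else
    { start := σ.start, sel := sel', cand := eliminate T x t σ }

/-- The state after `t` rounds. -/
noncomputable def stateAfter : ℕ → State K
  | 0 => { start := 1, sel := fun _ => ∅, cand := Finset.univ }
  | t + 1 => step L T tie reset x (t + 1) (stateAfter t)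

/-- The selection sequence `I(t)`. -/
noncomputable def selection (t : ℕ) : Finset (Fin K) := (stateAfter L T tie reset x t).sel t

/-- The selection sequence of Elimination-UCB as a base algorithm, without resets. -/
noncomputable def elimUCB (t : ℕ) : Finset (Fin K) := selection L T tie (noReset K) x t

/-- The selection sequence of the adaptive resetting bandit with base algorithm Elimination-UCB. -/
noncomputable def adrElimUCB (δ : ℝ) (t : ℕ) : Finset (Fin K) :=
  selection L T tie (adrReset K δ) x t

/-- The first round of the window in force in round `t + 1` of the adaptive resetting bandit: the
round after the last reset before round `t + 1`, or `1` if there was none. -/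
noncomputable def adrWindowStart (δ : ℝ) (t : ℕ) : ℕ :=
  (stateAfter L T tie (adrReset K δ) x t).start

end

end ElimUCB

/-! Monitoring consistency is deterministic. An elimination removes one arm and needs two
candidates, so the candidate set is never empty, and between resets it only shrinks. An arm still in
it was a candidate throughout the window, hence was drawn in each of its turns, and turns recur
every `K` rounds.

Both regret bounds rest on `gap_le`, valid when the empirical means are `Concentrated`. For an arm
selected by its index this is the usual UCB comparison. For a candidate `k` drawn in its turn,
compare it with the best arm `b` of the current round. If `b` was still a candidate at the previous
turn of `k`, then `k` survived a test against `b` with about `t / K` turn samples each. Otherwise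
`b` was eliminated although it is best now. Concentration uses only part of the confidence radius,
so the radius of `b` at its elimination must be of the order of the drift
(`radius_le_of_upper_lt_lower`). Less than `K` rounds earlier `k` survived a test against `b` with
the same samples of `b`, so the gap of `k` is of the order of the drift too
(`gap_le_of_eliminated`).

In each round `sum_sub_sum_le` pairs wrongly selected with wrongly omitted arms. Summing and
Cauchy-Schwarz give the bound `√(L * K * S)`. In the stationary case only bounds of at least the
minimal gap count, which leaves `K * log T / d`.

Concentration fails with probability at most `4 * K / T ^ 2`: an exponential supermartingale along
the first `n` samples (`lintegral_prod_le_one`, `measure_sum_ge_le`) is combined with a union over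
arms, sample sizes and the two kinds of samples. On failure the regret is at most `L * T`, so the
expectation gains only a constant. -/

namespace ElimUCB

/-! ### Candidate sets and monitoring, with or without resets -/

section States

variable {K : ℕ} [NeZero K] (L T : ℕ) (tie : TieRule K) (reset : ResetRule K)
  (x : ℕ → Fin K → ℝ)

theorem exists_arm_eq (i : Fin K) (u : ℕ) : ∃ t ∈ Finset.Icc u (u + K - 1), arm K t = i := by
  have hK : 0 < K := NeZero.pos K
  have hmod : u % K < K := Nat.mod_lt _ hK
  refine ⟨u + (i + (K - u % K)) % K, ?_, ?_⟩
  · have := Nat.mod_lt (i + (K - u % K)) hK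
    simp only [Finset.mem_Icc]
    omega
  · apply Fin.ext
    change (u + (i + (K - u % K)) % K) % K = i
    have h : u + (i + (K - u % K)) = i + K * (u / K + 1) := by
      have := Nat.div_add_mod u K
      rw [mul_add]
      omega
    rw [Nat.add_mod_mod, h, Nat.add_mul_mod_self_left, Nat.mod_eq_of_lt i.isLt]

theorem step_sel (t : ℕ) (σ : State K) :
    (step L T tie reset x t σ).sel = Function.update σ.sel t (select L T tie x t σ) := by
  unfold step
  dsimp only
  split_ifs <;> rfl

theorem stateAfter_sel_of_le {s t : ℕ} (h : s ≤ t) :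
    (stateAfter L T tie reset x t).sel s = selection L T tie reset x s := by
  induction t, h using Nat.le_induction with
  | base => rfl
  | succ t hst ih =>
    rw [stateAfter, step_sel, Function.update_of_ne (by omega), ih]

theorem selection_succ (t : ℕ) :
    selection L T tie reset x (t + 1)
      = select L T tie x (t + 1) (stateAfter L T tie reset x t) := by
  rw [selection, stateAfter, step_sel, Function.update_self]

theorem eliminate_subset (t : ℕ) (σ : State K) : eliminate T x t σ ⊆ σ.cand := by
  unfold eliminate
  dsimp only
  split_ifs
  · exact Finset.erase_subset _ _
  · exact Finset.Subset.refl _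

theorem eliminate_nonempty (t : ℕ) (σ : State K) (h : σ.cand.Nonempty) :
    (eliminate T x t σ).Nonempty := by
  unfold eliminate
  dsimp only
  split_ifs with h2
  · rw [← Finset.card_pos]
    have := Finset.pred_card_le_card_erase (s := σ.cand) (a := arm K t)
    omega
  · exact h

theorem cand_nonempty (t : ℕ) : (stateAfter L T tie reset x t).cand.Nonempty := by
  induction t with
  | zero => exact Finset.univ_nonempty
  | succ t ih =>
    rw [stateAfter, step]
    split_ifs
    · exact Finset.univ_nonempty
    · exact eliminate_nonempty _ _ _ _ ih

theorem one_le_start (t : ℕ) : 1 ≤ (stateAfter L T tie reset x t).start := by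
  induction t with
  | zero => exact le_rfl
  | succ t ih =>
    rw [stateAfter, step]
    split_ifs
    · exact Nat.succ_pos _
    · exact ih

/-- The bound on `start` says that no reset happened after round `s`, and without resets the
candidates change only by elimination. -/
theorem cand_subset_of_start_le {s t : ℕ} (hs : (stateAfter L T tie reset x t).start ≤ s + 1)
    (hst : s ≤ t) :
    (stateAfter L T tie reset x t).cand ⊆ (stateAfter L T tie reset x s).cand := by
  induction t, hst using Nat.le_induction with
  | base => exact Finset.Subset.refl _
  | succ t hst ih =>
    rw [stateAfter, step] at hs ⊢
    split_ifs at hs ⊢ with hr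
    · dsimp only at hs
      omega
    · exact (eliminate_subset _ _ _ _).trans (ih hs)

theorem arm_mem_selection {t : ℕ} (h : arm K (t + 1) ∈ (stateAfter L T tie reset x t).cand) :
    arm K (t + 1) ∈ selection L T tie reset x (t + 1) := by
  rw [selection_succ, select, if_pos h]
  exact Finset.mem_insert_self _ _

theorem monitoringConsistentOn_selection (t : ℕ) :
    MonitoringConsistentOn K (stateAfter L T tie reset x t).start (t + 1)
      (selection L T tie reset x) := by
  -- Any surviving candidate can serve as the monitored arm.
  obtain ⟨i, hi⟩ := cand_nonempty L T tie reset x t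
  have hK : 0 < K := NeZero.pos K
  refine ⟨i, fun u hu => ?_⟩
  obtain ⟨t', ht', rfl⟩ := exists_arm_eq i u
  refine ⟨t', ht', ?_⟩
  have h1 := one_le_start L T tie reset x t
  simp only [Finset.mem_Icc] at hu ht'
  obtain ⟨s, rfl⟩ : ∃ s, t' = s + 1 := ⟨t' - 1, by omega⟩
  exact arm_mem_selection L T tie reset x
    (cand_subset_of_start_le L T tie reset x (by omega) (by omega) hi)

end States

/-! ### Top sets and round-robin counts -/

/-- A tie rule is constrained on nonempty families only. A member is built greedily, by adding to a
top set a remaining arm of largest index. -/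
theorem topSets_nonempty {K : ℕ} (U : Fin K → EReal) (avail : Finset (Fin K)) (m : ℕ)
    (h : m ≤ avail.card) : (topSets U avail m).Nonempty := by
  induction m with
  | zero => exact ⟨∅, by simp [topSets]⟩
  | succ m ih =>
    obtain ⟨A, hA⟩ := ih (by omega)
    simp only [topSets, Finset.mem_filter, Finset.mem_powersetCard] at hA
    obtain ⟨⟨hsub, hcard⟩, htop⟩ := hA
    have hne : (avail \ A).Nonempty := by
      rw [← Finset.card_pos, Finset.card_sdiff_of_subset hsub]
      omega
    obtain ⟨a, ha, hmax⟩ := Finset.exists_max_image (avail \ A) U hne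
    have ha' := Finset.mem_sdiff.1 ha
    refine ⟨insert a A, ?_⟩
    simp only [topSets, Finset.mem_filter, Finset.mem_powersetCard]
    refine ⟨⟨Finset.insert_subset ha'.1 hsub, by rw [Finset.card_insert_of_notMem ha'.2, hcard]⟩,
      fun i hi j hj => ?_⟩
    rw [Finset.mem_sdiff, Finset.mem_insert, not_or] at hj
    have hj' : j ∈ avail \ A := Finset.mem_sdiff.2 ⟨hj.1, hj.2.2⟩
    rcases Finset.mem_insert.1 hi with rfl | hi
    · exact hmax j hj'
    · exact htop i hi j hj'

theorem arm_eq_iff {K : ℕ} [NeZero K] (s : ℕ) (i : Fin K) : arm K s = i ↔ s ≡ i [MOD K] := by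
  rw [Fin.ext_iff, Nat.ModEq, Nat.mod_eq_of_lt i.isLt]
  rfl

/-- Counting residues from `0` on includes round `0`, a turn of arm `0` only. Discarding it leaves
`t / K` or one more. -/
theorem card_filter_arm {K : ℕ} [NeZero K] (t : ℕ) (i : Fin K) :
    t / K ≤ ((Finset.Ico 1 (t + 1)).filter fun s => arm K s = i).card ∧
      ((Finset.Ico 1 (t + 1)).filter fun s => arm K s = i).card ≤ t / K + 1 := by
  have hK : 0 < K := NeZero.pos K
  have h1 := Nat.count_modEq_card (t + 1) hK (i : ℕ)
  rw [Nat.count_eq_card_filter_range, Finset.card_filter, Finset.range_eq_Ico,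
    Finset.sum_eq_sum_Ico_succ_bot (Nat.succ_pos t), zero_add] at h1
  simp only [arm_eq_iff, Finset.card_filter]
  have hmod : ((0 : ℕ) ≡ i [MOD K]) ↔ (i : ℕ) = 0 := by
    rw [Nat.ModEq, Nat.zero_mod, Nat.mod_eq_of_lt i.isLt, eq_comm]
  have h2 := Nat.succ_div (a := t) (b := K)
  have h3 : K ∣ t + 1 ↔ (t + 1) % K = 0 := Nat.dvd_iff_mod_eq_zero
  rw [Nat.mod_eq_of_lt i.isLt] at h1
  simp only [hmod, h3] at h1 h2
  have h4 : (if (i : ℕ) = 0 then 1 else 0)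
      + (∑ s ∈ Finset.Ico 1 (t + 1), if s ≡ i [MOD K] then 1 else 0)
        = (t + 1) / K + if (i : ℕ) < (t + 1) % K then 1 else 0 := by
    convert h1
  have h5 := i.isLt
  clear h1
  generalize (∑ s ∈ Finset.Ico 1 (t + 1), if s ≡ i [MOD K] then 1 else 0) = c at h4 ⊢
  split_ifs at h4 h2 <;> omega

/-! ### Elimination-UCB without resets -/

section Base

variable {K : ℕ} [NeZero K] (L T : ℕ) (tie : TieRule K) (x : ℕ → Fin K → ℝ)

/-- The state of Elimination-UCB, run without resets, after `t` rounds. -/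
noncomputable abbrev baseState (t : ℕ) : State K := stateAfter L T tie (noReset K) x t

theorem baseState_succ (t : ℕ) :
    baseState L T tie x (t + 1) =
      { start := (baseState L T tie x t).start
        sel := Function.update (baseState L T tie x t).sel (t + 1)
          (select L T tie x (t + 1) (baseState L T tie x t))
        cand := eliminate T x (t + 1) (baseState L T tie x t) } := by
  simp only [baseState]
  rw [stateAfter, step]
  exact if_neg id

theorem baseState_start (t : ℕ) : (baseState L T tie x t).start = 1 := by
  induction t with
  | zero => rfl
  | succ t ih => rw [baseState_succ]; exact ih

theorem monitoringConsistent_elimUCB : MonitoringConsistent K T (elimUCB L T tie x) := by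
  have hK : 0 < K := NeZero.pos K
  cases T with
  | zero =>
    refine ⟨arm K 0, fun t ht => ?_⟩
    simp only [Finset.mem_Icc] at ht
    omega
  | succ t =>
    have h := monitoringConsistentOn_selection L (t + 1) tie (noReset K) x t
    rwa [show (stateAfter L (t + 1) tie (noReset K) x t).start = 1 from
      baseState_start L (t + 1) tie x t] at h

theorem baseState_cand_anti : Antitone fun t => (baseState L T tie x t).cand := by
  intro s t hst
  refine cand_subset_of_start_le L T tie (noReset K) x ?_ hst
  have := baseState_start L T tie x t
  simp only [baseState] at this
  omega

theorem samples_baseState (t : ℕ) (i : Fin K) :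
    samples (baseState L T tie x t).sel (Finset.Ico (baseState L T tie x t).start (t + 1)) i
      = samples (elimUCB L T tie x) (Finset.Ico 1 (t + 1)) i := by
  rw [baseState_start]
  refine Finset.filter_congr fun s hs => ?_
  rw [Finset.mem_Ico] at hs
  rw [stateAfter_sel_of_le L T tie (noReset K) x (by omega : s ≤ t)]
  rfl

theorem samplesE_baseState (t : ℕ) (i : Fin K) :
    samplesE (baseState L T tie x t).sel (Finset.Ico (baseState L T tie x t).start (t + 1)) i
      = samplesE (elimUCB L T tie x) (Finset.Ico 1 (t + 1)) i := by
  rw [baseState_start]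
  refine Finset.filter_congr fun s hs => ?_
  rw [Finset.mem_Ico] at hs
  rw [stateAfter_sel_of_le L T tie (noReset K) x (by omega : s ≤ t)]
  rfl

variable {L}

/-- Every arm selected by its index, rather than as a candidate in its turn, has an index at least
as large as the arms left out. -/
theorem elimUCB_succ_spec (hL : 1 ≤ L) (hLK : L ≤ K) (t : ℕ) :
    (elimUCB L T tie x (t + 1)).card = L ∧
      ∀ i ∈ elimUCB L T tie x (t + 1), ∀ j ∉ elimUCB L T tie x (t + 1),
        (i = arm K (t + 1) ∧ i ∈ (baseState L T tie x t).cand) ∨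
        upper T x (samples (elimUCB L T tie x) (Finset.Ico 1 (t + 1)) j) j
          ≤ upper T x (samples (elimUCB L T tie x) (Finset.Ico 1 (t + 1)) i) i := by
  have hsel : elimUCB L T tie x (t + 1) = select L T tie x (t + 1) (baseState L T tie x t) :=
    selection_succ L T tie (noReset K) x t
  unfold select at hsel
  simp only [samples_baseState] at hsel
  set U : Fin K → EReal := fun i =>
    upper T x (samples (elimUCB L T tie x) (Finset.Ico 1 (t + 1)) i) i with hU
  split_ifs at hsel with hc
  · have hmem := tie.pick_mem (t + 1) (baseState L T tie x t) _
      (topSets_nonempty U (Finset.univ.erase (arm K (t + 1))) (L - 1)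
        (by rw [Finset.card_erase_of_mem (Finset.mem_univ _), Finset.card_univ,
              Fintype.card_fin]; omega))
    rw [hsel]
    set A := tie.pick (t + 1) (baseState L T tie x t)
      (topSets U (Finset.univ.erase (arm K (t + 1))) (L - 1))
    simp only [topSets, Finset.mem_filter, Finset.mem_powersetCard] at hmem
    obtain ⟨⟨hsub, hcard⟩, htop⟩ := hmem
    have hk : arm K (t + 1) ∉ A := fun h => by simpa using hsub h
    refine ⟨by rw [Finset.card_insert_of_notMem hk]; omega, fun i hi j hj => ?_⟩
    rcases Finset.mem_insert.1 hi with rfl | hi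
    · exact Or.inl ⟨rfl, hc⟩
    · rw [Finset.mem_insert, not_or] at hj
      exact Or.inr (htop i hi j (by simp [hj]))
  · have hmem := tie.pick_mem (t + 1) (baseState L T tie x t) _
      (topSets_nonempty U Finset.univ L (by simpa using hLK))
    rw [hsel]
    simp only [topSets, Finset.mem_filter, Finset.mem_powersetCard] at hmem
    obtain ⟨⟨hsub, hcard⟩, htop⟩ := hmem
    exact ⟨hcard, fun i hi j hj => Or.inr (htop i hi j
      (Finset.mem_sdiff.2 ⟨Finset.mem_univ _, hj⟩))⟩

variable (L)

/-- A candidate that survives its elimination test is not dominated by another candidate. -/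
theorem lower_le_upper_of_mem_cand {t : ℕ} {b : Fin K}
    (hk : arm K (t + 1) ∈ (baseState L T tie x (t + 1)).cand)
    (hb : b ∈ (baseState L T tie x t).cand) (hne : b ≠ arm K (t + 1)) :
    lower T x (samplesE (elimUCB L T tie x) (Finset.Ico 1 (t + 1)) b) b
      ≤ upper T x (samplesE (elimUCB L T tie x) (Finset.Ico 1 (t + 1)) (arm K (t + 1)))
        (arm K (t + 1)) := by
  have hk0 := baseState_cand_anti L T tie x t.le_succ hk
  rw [baseState_succ, eliminate] at hk
  simp only [samplesE_baseState] at hk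
  split_ifs at hk with h
  · simp at hk
  · rw [not_and_or, not_exists] at h
    rcases h with h | h
    · exact absurd (Finset.one_lt_card.2 ⟨b, hb, _, hk0, hne⟩) (by omega)
    · exact not_lt.1 (h b)

/-- An arm that is no longer a candidate was dominated in one of its turns. -/
theorem exists_elimination {t : ℕ} {b : Fin K} (hb : b ∉ (baseState L T tie x t).cand) :
    ∃ s < t, arm K (s + 1) = b ∧ b ∈ (baseState L T tie x s).cand ∧ ∃ i,
      upper T x (samplesE (elimUCB L T tie x) (Finset.Ico 1 (s + 1)) b) b
        < lower T x (samplesE (elimUCB L T tie x) (Finset.Ico 1 (s + 1)) i) i := by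
  induction t with
  | zero => exact absurd (Finset.mem_univ b) hb
  | succ t ih =>
    by_cases hbt : b ∈ (baseState L T tie x t).cand
    · rw [baseState_succ, eliminate] at hb
      simp only [samplesE_baseState] at hb
      split_ifs at hb with h
      · rw [Finset.mem_erase, not_and_or, not_not] at hb
        have hb' : b = arm K (t + 1) := hb.resolve_right (not_not.2 hbt)
        exact ⟨t, t.lt_succ_self, hb'.symm, hbt, by rw [hb']; exact h.2⟩
      · exact absurd hbt hb
    · obtain ⟨s, hs, h⟩ := ih hbt
      exact ⟨s, hs.trans t.lt_succ_self, h⟩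

/-- In its turns a candidate is always selected. -/
theorem samplesE_of_mem_cand {t : ℕ} {b : Fin K} (hb : b ∈ (baseState L T tie x t).cand) :
    samplesE (elimUCB L T tie x) (Finset.Ico 1 (t + 1)) b
      = (Finset.Ico 1 (t + 1)).filter fun s => arm K s = b := by
  refine Finset.filter_congr fun s hs => ⟨fun h => h.2.symm, ?_⟩
  rintro rfl
  rw [Finset.mem_Ico] at hs
  obtain ⟨s, rfl⟩ : ∃ r, s = r + 1 := ⟨s - 1, by omega⟩
  exact ⟨arm_mem_selection L T tie (noReset K) x
    (baseState_cand_anti L T tie x (by omega : s ≤ t) hb), rfl⟩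

end Base
-- Drift of the means
section Drift

variable {K : ℕ} (μ : ℕ → Fin K → ℝ)

theorem iSup_abs_nonneg (s : ℕ) : 0 ≤ ⨆ i, |μ s i - μ (s + 1) i| :=
  Real.iSup_nonneg fun _ => abs_nonneg _

theorem drift_nonneg (t : ℕ) : 0 ≤ drift μ t :=
  Finset.sum_nonneg fun s _ => iSup_abs_nonneg μ s

theorem drift_const (m : Fin K → ℝ) (t : ℕ) : drift (fun _ => m) t = 0 := by
  simp [drift]

theorem abs_sub_le_drift {s t : ℕ} (hs : 1 ≤ s) (hst : s ≤ t) (i : Fin K) :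
    |μ s i - μ t i| ≤ drift μ t := by
  have h1 := dist_le_Ico_sum_dist (fun u => μ u i) hst
  rw [Real.dist_eq] at h1
  calc |μ s i - μ t i| ≤ ∑ u ∈ Finset.Ico s t, dist (μ u i) (μ (u + 1) i) := h1
    _ ≤ ∑ u ∈ Finset.Ico s t, ⨆ i, |μ u i - μ (u + 1) i| := by
        refine Finset.sum_le_sum fun u _ => ?_
        rw [Real.dist_eq]
        exact le_ciSup (f := fun i => |μ u i - μ (u + 1) i|) (Set.finite_range _).bddAbove i
    _ ≤ drift μ t :=
        Finset.sum_le_sum_of_subset_of_nonneg (Finset.Ico_subset_Ico hs le_rfl)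
          fun u _ _ => iSup_abs_nonneg μ u

/-- Each averaged mean is within the drift of the current one, so drift is the whole price of using
old samples. -/
theorem abs_empMean_sub_le_drift {A : Finset ℕ} {t : ℕ} (hA : A ⊆ Finset.Ico 1 (t + 1))
    (hne : A ≠ ∅) (i : Fin K) : |empMean μ A i - μ t i| ≤ drift μ t := by
  have hc : (0 : ℝ) < A.card := by
    exact_mod_cast Finset.card_pos.2 (Finset.nonempty_iff_ne_empty.2 hne)
  have h : empMean μ A i - μ t i = (∑ s ∈ A, (μ s i - μ t i)) / A.card := by
    rw [empMean, Finset.sum_sub_distrib, Finset.sum_const, nsmul_eq_mul]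
    field_simp
  rw [h, abs_div, abs_of_pos hc, div_le_iff₀ hc]
  calc |∑ s ∈ A, (μ s i - μ t i)| ≤ ∑ s ∈ A, |μ s i - μ t i| := Finset.abs_sum_le_sum_abs _ _
    _ ≤ ∑ _s ∈ A, drift μ t := Finset.sum_le_sum fun s hs => by
        have := Finset.mem_Ico.1 (hA hs)
        exact abs_sub_le_drift μ this.1 (by omega) i
    _ = drift μ t * A.card := by rw [Finset.sum_const, nsmul_eq_mul, mul_comm]

end Drift

/-! ### Confidence radii -/

section Radius

theorem radius_eq (T n : ℕ) : radius T n = √(2 * Real.log T / n) := by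
  rw [radius, Real.log_pow]
  congr 1
  rw [show ((4 : ℕ) : ℝ) * Real.log T = 2 * (2 * Real.log T) by push_cast; ring,
    mul_div_mul_left _ _ two_ne_zero]

theorem radius_nonneg (T n : ℕ) : 0 ≤ radius T n := Real.sqrt_nonneg _

theorem log_natCast_nonneg (T : ℕ) : 0 ≤ Real.log T := Real.log_natCast_nonneg T

theorem two_thirds_le_log {T : ℕ} (hT : 2 ≤ T) : 2 / 3 ≤ Real.log T := by
  have h1 := Real.log_two_gt_d9
  have h2 : Real.log 2 ≤ Real.log T :=
    Real.log_le_log two_pos (by exact_mod_cast hT)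
  linarith

theorem radius_anti (T : ℕ) {m n : ℕ} (hm : 1 ≤ m) (h : m ≤ n) : radius T n ≤ radius T m := by
  rw [radius_eq, radius_eq]
  have := log_natCast_nonneg T
  have hm' : (1 : ℝ) ≤ m := by exact_mod_cast hm
  have h' : (m : ℝ) ≤ n := by exact_mod_cast h
  gcongr

/-- As `n ≤ 4 * (n - 1)`, one sample fewer costs at most a factor two. This handles two arms whose
numbers of turns differ by one. -/
theorem radius_pred_le (T : ℕ) {n : ℕ} (hn : 2 ≤ n) : radius T (n - 1) ≤ 2 * radius T n := by
  rw [radius_eq, radius_eq, show (2 : ℝ) = √4 by norm_num [Real.sqrt_eq_iff_mul_self_eq],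
    ← Real.sqrt_mul (by norm_num), show √4 = (2 : ℝ) by norm_num [Real.sqrt_eq_iff_mul_self_eq]]
  apply Real.sqrt_le_sqrt
  have := log_natCast_nonneg T
  have hn' : (2 : ℝ) ≤ n := by exact_mod_cast hn
  rw [Nat.cast_sub (by omega), Nat.cast_one, mul_div_assoc',
    div_le_div_iff₀ (by linarith) (by linarith)]
  nlinarith

theorem one_le_radius_one {T : ℕ} (hT : 2 ≤ T) : 1 ≤ radius T 1 := by
  rw [radius_eq, Real.one_le_sqrt]
  have := two_thirds_le_log hT
  simp only [Nat.cast_one, div_one]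
  linarith

/-- Concentration thus leaves an eighth of each radius as slack, which the elimination argument
spends. -/
theorem sqrt_three_div_two_le : √3 / 2 ≤ 7 / 8 := by
  rw [div_le_iff₀ two_pos, Real.sqrt_le_left (by norm_num)]
  norm_num

end Radius

/-! ### What a comparison of confidence bounds says about the means -/

section Comparisons

variable {K : ℕ} {T : ℕ} {x : ℕ → Fin K → ℝ} {A B : Finset ℕ} {i j : Fin K} {m : Fin K → ℝ}
  {D : ℝ}

theorem nonempty_of_upper_lt_lower (h : upper T x A i < lower T x B j) : A ≠ ∅ ∧ B ≠ ∅ := by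
  constructor <;> rintro rfl
  · simp [upper] at h
  · simp [lower] at h

theorem sub_le_of_lower_le_upper (hA : A ≠ ∅) (hB : B ≠ ∅)
    (hAi : |empMean x A i - m i| ≤ √3 / 2 * radius T A.card + D)
    (hBj : |empMean x B j - m j| ≤ √3 / 2 * radius T B.card + D)
    (h : lower T x B j ≤ upper T x A i) :
    m j - m i ≤ 2 * D + 2 * radius T A.card + 2 * radius T B.card := by
  rw [lower, upper, if_neg hA, if_neg hB, EReal.coe_le_coe_iff] at h
  have h1 := (abs_le.1 hAi).2
  have h2 := (abs_le.1 hBj).1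
  have h3 := sqrt_three_div_two_le
  have h4 := radius_nonneg T A.card
  have h5 := radius_nonneg T B.card
  nlinarith

/-- An eighth of each radius is not explained by noise. When `i` is at least as good as `j`, only
the two errors `D` can pay for it. -/
theorem radius_le_of_upper_lt_lower
    (hAi : |empMean x A i - m i| ≤ √3 / 2 * radius T A.card + D)
    (hBj : |empMean x B j - m j| ≤ √3 / 2 * radius T B.card + D)
    (h : upper T x A i < lower T x B j) (hmax : m j ≤ m i) :
    radius T A.card ≤ 16 * D := by
  obtain ⟨hA, hB⟩ := nonempty_of_upper_lt_lower h
  rw [lower, upper, if_neg hA, if_neg hB, EReal.coe_lt_coe_iff] at h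
  have h1 := (abs_le.1 hAi).1
  have h2 := (abs_le.1 hBj).2
  have h3 := sqrt_three_div_two_le
  have h4 := radius_nonneg T A.card
  have h5 := radius_nonneg T B.card
  nlinarith

/-- Passing from `n` to `n + 1` with a doubled constant includes the unsampled arm and allows
summation over sample numbers starting at `0`. -/
theorem sub_le_of_upper_le_upper (hT : 2 ≤ T) (hD : 0 ≤ D) (hm : m j - m i ≤ 1)
    (hAi : A ≠ ∅ → |empMean x A i - m i| ≤ √3 / 2 * radius T A.card + D)
    (hBj : B ≠ ∅ → |empMean x B j - m j| ≤ √3 / 2 * radius T B.card + D)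
    (h : upper T x B j ≤ upper T x A i) :
    m j - m i ≤ 2 * D + √(16 * Real.log T / (A.card + 1)) := by
  have hlog := two_thirds_le_log hT
  by_cases hA : A = ∅
  · have : 1 ≤ √(16 * Real.log T / (A.card + 1)) := by
      rw [hA, Real.one_le_sqrt]
      simp only [Finset.card_empty, Nat.cast_zero, zero_add, div_one]
      linarith
    linarith
  · have hB : B ≠ ∅ := by
      rintro rfl
      rw [upper, upper, if_pos rfl, if_neg hA, top_le_iff] at h
      exact EReal.coe_ne_top _ h
    specialize hAi hA
    specialize hBj hB
    rw [upper, upper, if_neg hA, if_neg hB, EReal.coe_le_coe_iff] at h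
    have h1 := (abs_le.1 hAi).2
    have h2 := (abs_le.1 hBj).1
    have h3 := sqrt_three_div_two_le
    have h4 := radius_nonneg T A.card
    have h5 := radius_nonneg T B.card
    have h6 : 2 * radius T A.card ≤ √(16 * Real.log T / (A.card + 1)) := by
      have hc : (1 : ℝ) ≤ A.card := by
        exact_mod_cast Finset.card_pos.2 (Finset.nonempty_iff_ne_empty.2 hA)
      apply Real.le_sqrt_of_sq_le
      rw [mul_pow, radius_eq, Real.sq_sqrt (by positivity), mul_div_assoc',
        div_le_div_iff₀ (by linarith) (by linarith)]
      nlinarith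
    nlinarith

end Comparisons

/-- All empirical means are within `√3 / 2` times the confidence radius of the average of the means
over the same rounds. -/
structure Concentrated {K : ℕ} [NeZero K] (T : ℕ) (x μ : ℕ → Fin K → ℝ)
    (I : ℕ → Finset (Fin K)) : Prop where
  all : ∀ t < T, ∀ i, samples I (Finset.Ico 1 (t + 1)) i ≠ ∅ →
    |empMean x (samples I (Finset.Ico 1 (t + 1)) i) i
        - empMean μ (samples I (Finset.Ico 1 (t + 1)) i) i|
      ≤ √3 / 2 * radius T (samples I (Finset.Ico 1 (t + 1)) i).card
  turn : ∀ t < T, ∀ i, samplesE I (Finset.Ico 1 (t + 1)) i ≠ ∅ →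
    |empMean x (samplesE I (Finset.Ico 1 (t + 1)) i) i
        - empMean μ (samplesE I (Finset.Ico 1 (t + 1)) i) i|
      ≤ √3 / 2 * radius T (samplesE I (Finset.Ico 1 (t + 1)) i).card

/-! ### Gaps of selected arms under concentration -/

section Gaps

variable {K : ℕ} [NeZero K] {L T : ℕ} {tie : TieRule K} {x μ : ℕ → Fin K → ℝ}

theorem Concentrated.abs_all_le {I : ℕ → Finset (Fin K)} (h : Concentrated T x μ I) {t : ℕ}
    (ht : t < T) {i : Fin K} (hne : samples I (Finset.Ico 1 (t + 1)) i ≠ ∅) :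
    |empMean x (samples I (Finset.Ico 1 (t + 1)) i) i - μ (t + 1) i|
      ≤ √3 / 2 * radius T (samples I (Finset.Ico 1 (t + 1)) i).card + drift μ (t + 1) := by
  have h1 := h.all t ht i hne
  have h2 := abs_empMean_sub_le_drift μ (A := samples I (Finset.Ico 1 (t + 1)) i) (t := t + 1)
    ((Finset.filter_subset _ _).trans (Finset.Ico_subset_Ico le_rfl (by omega))) hne i
  exact (abs_sub_le _ _ _).trans (add_le_add h1 h2)

/-- An old test, after `s ≤ t` rounds, is read against the means of round `t + 1`; the drift up to
then covers all earlier rounds. -/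
theorem Concentrated.abs_turn_le {I : ℕ → Finset (Fin K)} (h : Concentrated T x μ I) {s t : ℕ}
    (hst : s ≤ t) (ht : t < T) {i : Fin K} (hne : samplesE I (Finset.Ico 1 (s + 1)) i ≠ ∅) :
    |empMean x (samplesE I (Finset.Ico 1 (s + 1)) i) i - μ (t + 1) i|
      ≤ √3 / 2 * radius T (samplesE I (Finset.Ico 1 (s + 1)) i).card + drift μ (t + 1) := by
  have h1 := h.turn s (by omega) i hne
  have h2 := abs_empMean_sub_le_drift μ (A := samplesE I (Finset.Ico 1 (s + 1)) i) (t := t + 1)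
    ((Finset.filter_subset _ _).trans (Finset.Ico_subset_Ico le_rfl (by omega))) hne i
  exact (abs_sub_le _ _ _).trans (add_le_add h1 h2)

theorem div_le_card_samplesE {t : ℕ} {b : Fin K} (hb : b ∈ (baseState L T tie x t).cand) :
    t / K ≤ (samplesE (elimUCB L T tie x) (Finset.Ico 1 (t + 1)) b).card := by
  rw [samplesE_of_mem_cand L T tie x hb]
  exact (card_filter_arm t b).1

theorem card_samplesE_le (I : ℕ → Finset (Fin K)) (t : ℕ) (b : Fin K) :
    (samplesE I (Finset.Ico 1 (t + 1)) b).card ≤ t / K + 1 := by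
  refine (Finset.card_le_card fun s hs => ?_).trans (card_filter_arm t b).2
  rw [samplesE, Finset.mem_filter] at hs
  exact Finset.mem_filter.2 ⟨hs.1, hs.2.2.symm⟩

/-- Between two turns of an arm there are no rounds in which it has its turn. -/
theorem samplesE_eq_of_turn (I : ℕ → Finset (Fin K)) {u s : ℕ} (hus : u ≤ s) (hsu : s < u + K) :
    samplesE I (Finset.Ico 1 (s + 1)) (arm K (s + 1))
      = samplesE I (Finset.Ico 1 (u + 1)) (arm K (s + 1)) := by
  ext r
  simp only [samplesE, Finset.mem_filter, Finset.mem_Ico]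
  refine ⟨fun ⟨h1, h2, h3⟩ => ⟨⟨h1.1, ?_⟩, h2, h3⟩, fun ⟨h1, h2, h3⟩ => ⟨⟨h1.1, by omega⟩, h2, h3⟩⟩
  by_contra hr
  have hmod : s + 1 ≡ r [MOD K] := congrArg Fin.val h3
  have hdvd := (Nat.modEq_iff_dvd' (by omega : r ≤ s + 1)).1 hmod.symm
  have := Nat.le_of_dvd (by omega) hdvd
  omega

/-- If the best arm of round `t + 1` has been eliminated while `k` has not, then the drift up to
this round accounts for the gap of `k`. -/
theorem gap_le_of_eliminated (hT : 2 ≤ T) (hμ : ∀ s i, μ s i ∈ Set.Icc (0 : ℝ) 1)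
    (hc : Concentrated T x μ (elimUCB L T tie x)) {t : ℕ} (ht : t < T) {b k : Fin K}
    (hb : ∀ j, μ (t + 1) j ≤ μ (t + 1) b)
    (hbt : b ∉ (baseState L T tie x t).cand) (hk : k ∈ (baseState L T tie x t).cand) :
    μ (t + 1) b - μ (t + 1) k ≤ 100 * drift μ (t + 1) := by
  have hD := drift_nonneg μ (t + 1)
  obtain ⟨s, hst, hsb, hbs, i, hi⟩ := exists_elimination L T tie x hbt
  obtain ⟨hA, hB⟩ := nonempty_of_upper_lt_lower hi
  have hr := radius_le_of_upper_lt_lower (m := μ (t + 1))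
    (hc.abs_turn_le hst.le ht hA) (hc.abs_turn_le hst.le ht hB) hi (hb i)
  have hn1 := Finset.card_pos.2 (Finset.nonempty_iff_ne_empty.2 hA)
  have hn2 := card_samplesE_le (elimUCB L T tie x) s b
  by_cases hn : (samplesE (elimUCB L T tie x) (Finset.Ico 1 (s + 1)) b).card = 1
  -- A single sample has radius at least `1`, so `16 * drift` already exceeds any gap.
  · rw [hn] at hr
    have := one_le_radius_one hT
    have h1 := (hμ (t + 1) b).2
    have h2 := (hμ (t + 1) k).1
    linarith
  · have hK : 0 < K := NeZero.pos K
    have hsK : K ≤ s := by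
      by_contra h
      rw [Nat.div_eq_of_lt (by omega)] at hn2
      omega
    -- The turn of `k` among the `K` rounds ending with the fatal turn `s + 1` of `b`. No turn of
    -- `b` lies between, so `b` has the same turn samples in both tests.
    obtain ⟨u', hu', huk⟩ := exists_arm_eq k (s + 2 - K)
    rw [Finset.mem_Icc] at hu'
    obtain ⟨u, rfl⟩ : ∃ u, u' = u + 1 := ⟨u' - 1, by omega⟩
    have hbk : b ≠ k := fun h => hbt (h ▸ hk)
    have hus : u ≠ s := by
      rintro rfl
      exact hbk (hsb.symm.trans huk)
    have hkc : k ∈ (baseState L T tie x (u + 1)).cand :=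
      baseState_cand_anti L T tie x (by omega : u + 1 ≤ t) hk
    have hbc : b ∈ (baseState L T tie x u).cand :=
      baseState_cand_anti L T tie x (by omega : u ≤ s) hbs
    have heq := samplesE_eq_of_turn (elimUCB L T tie x) (by omega : u ≤ s) (by omega)
    rw [hsb] at heq
    rw [heq] at hr hn hn1 hA
    have hlow := lower_le_upper_of_mem_cand L T tie x (t := u) (b := b) (by rwa [huk])
      hbc (by rwa [huk])
    rw [huk] at hlow
    have hn3 := card_samplesE_le (elimUCB L T tie x) u b
    have hn4 := div_le_card_samplesE (L := L) (T := T) (tie := tie) (x := x)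
      (baseState_cand_anti L T tie x (Nat.le_succ u) hkc)
    have hkne : samplesE (elimUCB L T tie x) (Finset.Ico 1 (u + 1)) k ≠ ∅ := by
      rw [← Finset.nonempty_iff_ne_empty, ← Finset.card_pos]
      omega
    have hgap := sub_le_of_lower_le_upper (m := μ (t + 1)) hkne hA
      (hc.abs_turn_le (by omega) ht hkne) (hc.abs_turn_le (by omega) ht hA) hlow
    -- At its turn `k` has at most one sample fewer than `b`, hence at most twice its radius. The
    -- gap is at most `(2 + 6 * 16) * drift`.
    have hr1 := radius_pred_le T
      (n := (samplesE (elimUCB L T tie x) (Finset.Ico 1 (u + 1)) b).card) (by omega)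
    have hr2 := radius_anti T
      (m := (samplesE (elimUCB L T tie x) (Finset.Ico 1 (u + 1)) b).card - 1)
      (n := (samplesE (elimUCB L T tie x) (Finset.Ico 1 (u + 1)) k).card) (by omega) (by omega)
    linarith

/-- The gap of a candidate in its turn. -/
theorem gap_le_of_mem_cand (hT : 2 ≤ T) (hμ : ∀ s i, μ s i ∈ Set.Icc (0 : ℝ) 1)
    (hc : Concentrated T x μ (elimUCB L T tie x)) {t : ℕ} (ht : t < T)
    (hk : arm K (t + 1) ∈ (baseState L T tie x t).cand) (j : Fin K) :
    μ (t + 1) j - μ (t + 1) (arm K (t + 1))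
      ≤ 100 * drift μ (t + 1) + √(96 * K * Real.log T / (t + 1)) := by
  have hD := drift_nonneg μ (t + 1)
  have hK : 0 < K := NeZero.pos K
  have hK' : (0 : ℝ) < K := by exact_mod_cast hK
  have hlog := two_thirds_le_log hT
  obtain ⟨b, -, hb⟩ := Finset.exists_max_image Finset.univ (μ (t + 1)) Finset.univ_nonempty
  replace hb : ∀ j, μ (t + 1) j ≤ μ (t + 1) b := fun j => hb j (Finset.mem_univ j)
  refine (sub_le_sub_right (hb j) _).trans ?_
  set k := arm K (t + 1) with hkdef
  rcases lt_or_ge t (2 * K) with htK | htK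
  -- In the first rounds the square root is at least `1`.
  · have h1 := (hμ (t + 1) b).2
    have h2 := (hμ (t + 1) k).1
    have h3 : 1 ≤ √(96 * K * Real.log T / (t + 1)) := by
      rw [Real.one_le_sqrt, le_div_iff₀ (by positivity)]
      have : (t : ℝ) + 1 ≤ 2 * K := by exact_mod_cast htK
      nlinarith
    linarith
  · by_cases hbk : b = k
    · rw [hbk, sub_self]
      positivity
    -- Round `u + 1` is the previous turn of `k`.
    obtain ⟨u, rfl⟩ : ∃ u, t = u + K := ⟨t - K, by omega⟩
    have huk : arm K (u + 1) = k := by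
      rw [hkdef]
      apply Fin.ext
      change (u + 1) % K = (u + K + 1) % K
      rw [show u + K + 1 = u + 1 + K by ring, Nat.add_mod_right]
    by_cases hbu : b ∈ (baseState L T tie x u).cand
    · have hku := baseState_cand_anti L T tie x (by omega : u + 1 ≤ u + K) hk
      have hku0 := baseState_cand_anti L T tie x (Nat.le_succ u) hku
      have hlow := lower_le_upper_of_mem_cand L T tie x (t := u) (b := b) (by rwa [huk])
        hbu (by rwa [huk])
      rw [huk] at hlow
      have hn1 := div_le_card_samplesE hku0
      have hn2 := div_le_card_samplesE hbu
      have hn : 1 ≤ u / K := (Nat.one_le_div_iff hK).2 (by omega)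
      have hne : ∀ A : Finset ℕ, u / K ≤ A.card → A ≠ ∅ := by
        rintro A h rfl
        rw [Finset.card_empty] at h
        omega
      have hgap := sub_le_of_lower_le_upper (m := μ (u + K + 1)) (hne _ hn1) (hne _ hn2)
        (hc.abs_turn_le (by omega) ht (hne _ hn1)) (hc.abs_turn_le (by omega) ht (hne _ hn2)) hlow
      have hr1 := radius_anti T hn hn1
      have hr2 := radius_anti T hn hn2
      -- With `n = u / K ≥ 1` one has `u + K + 1 ≤ 3 * K * n`, which turns `16 * 2` into `96 * K`.
      have hr : 4 * radius T (u / K) ≤ √(96 * K * Real.log T / ((u + K : ℕ) + 1)) := by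
        apply Real.le_sqrt_of_sq_le
        have hn' : (1 : ℝ) ≤ (u / K : ℕ) := by exact_mod_cast hn
        have huK : (u : ℝ) + K + 1 ≤ K * (u / K : ℕ) + 2 * K := by
          have h1 := Nat.div_add_mod u K
          have h2 := Nat.mod_lt u hK
          have h3 : u + K + 1 ≤ K * (u / K) + 2 * K := by omega
          exact_mod_cast h3
        rw [mul_pow, radius_eq, Real.sq_sqrt (by positivity), mul_div_assoc',
          div_le_div_iff₀ (by linarith) (by positivity)]
        push_cast
        generalize ((u / K : ℕ) : ℝ) = n at hn' huK ⊢
        have h4 : (u : ℝ) + K + 1 ≤ 3 * (K * n) := by nlinarith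
        nlinarith
      linarith
    · have h1 := gap_le_of_eliminated hT hμ hc ht hb
        (fun h => hbu (baseState_cand_anti L T tie x (by omega : u ≤ u + K) h)) hk
      exact h1.trans (le_add_of_nonneg_right (Real.sqrt_nonneg _))

/-- The gap between an arm that is selected and one that is not. -/
theorem gap_le (hL : 1 ≤ L) (hLK : L ≤ K) (hT : 2 ≤ T)
    (hμ : ∀ s i, μ s i ∈ Set.Icc (0 : ℝ) 1)
    (hc : Concentrated T x μ (elimUCB L T tie x)) {t : ℕ} (ht : t < T) {i j : Fin K}
    (hi : i ∈ elimUCB L T tie x (t + 1)) (hj : j ∉ elimUCB L T tie x (t + 1)) :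
    (i = arm K (t + 1) ∧
      μ (t + 1) j - μ (t + 1) i ≤ 100 * drift μ (t + 1) + √(96 * K * Real.log T / (t + 1))) ∨
    μ (t + 1) j - μ (t + 1) i ≤ 2 * drift μ (t + 1) + √(16 * Real.log T /
      ((samples (elimUCB L T tie x) (Finset.Ico 1 (t + 1)) i).card + 1)) := by
  rcases (elimUCB_succ_spec T tie x hL hLK t).2 i hi j hj with ⟨rfl, hcand⟩ | hU
  · exact Or.inl ⟨rfl, gap_le_of_mem_cand hT hμ hc ht hcand j⟩
  · refine Or.inr (sub_le_of_upper_le_upper hT (drift_nonneg μ _) ?_ (hc.abs_all_le ht)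
      (hc.abs_all_le ht) hU)
    have h1 := (hμ (t + 1) j).2
    have h2 := (hμ (t + 1) i).1
    linarith

end Gaps

/-! ### A concentration inequality for adaptively chosen samples -/

section Concentration

variable {Ω E : Type*} [MeasurableSpace E]

/-- The events determined by the values of `x` before time `t`. -/
abbrev past (x : ℕ → Ω → E) (t : ℕ) : MeasurableSpace Ω :=
  ⨆ s ∈ Set.Iio t, MeasurableSpace.comap (x s) inferInstance

theorem comap_le_past (x : ℕ → Ω → E) {s t : ℕ} (h : s < t) :
    MeasurableSpace.comap (x s) inferInstance ≤ past x t :=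
  le_iSup₂_of_le s h le_rfl

theorem past_mono (x : ℕ → Ω → E) {s t : ℕ} (h : s ≤ t) : past x s ≤ past x t :=
  iSup₂_le fun _ hr => comap_le_past x (lt_of_lt_of_le hr h)

variable [MeasurableSpace Ω] {P : Measure Ω}

theorem past_le {x : ℕ → Ω → E} (hx : ∀ t, Measurable (x t)) (t : ℕ) :
    past x t ≤ inferInstanceAs (MeasurableSpace Ω) :=
  iSup₂_le fun s _ => (hx s).comap_le

theorem indep_past {x : ℕ → Ω → E} (hx : ∀ t, Measurable (x t)) (h : iIndepFun x P) (t : ℕ) :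
    Indep (past x t) (MeasurableSpace.comap (x t) inferInstance) P := by
  have h1 := indep_iSup_of_disjoint (fun s => (hx s).comap_le)
    ((iIndepFun_iff_iIndep _ _ _).1 h) (S := Set.Iio t) (T := {t}) (by simp)
  simp only [Set.mem_singleton_iff, iSup_iSup_eq_left] at h1
  exact h1

/-- A product of independent factors of mean at most one, each of which is used or skipped
depending on the past, has mean at most one. -/
theorem lintegral_prod_le_one [IsProbabilityMeasure P] {x : ℕ → Ω → E}
    (hx : ∀ t, Measurable (x t)) (hind : iIndepFun x P) {g : ℕ → E → ENNReal}
    (hg : ∀ s, Measurable (g s)) (hg1 : ∀ s, ∫⁻ ω, g s (x s ω) ∂P ≤ 1)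
    {J : ℕ → Ω → Prop} (hJ : ∀ s, MeasurableSet[past x s] {ω | J s ω}) (t : ℕ) :
    ∫⁻ ω, ∏ s ∈ Finset.range t, (if J s ω then g s (x s ω) else 1) ∂P ≤ 1 := by
  have hmeas : ∀ t, Measurable[past x t]
      fun ω => ∏ s ∈ Finset.range t, (if J s ω then g s (x s ω) else 1) := by
    intro t
    refine @Finset.measurable_fun_prod _ _ _ _ _ _ (past x t) _ (Finset.range t) fun s hs => ?_
    have hs' := Finset.mem_range.1 hs
    refine Measurable.ite (past_mono x hs'.le _ (hJ s)) ?_ measurable_const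
    exact (hg s).comp ((comap_measurable (x s)).mono (comap_le_past x hs') le_rfl)
  induction t with
  | zero => simp
  | succ t ih =>
    set Y : Ω → ENNReal := fun ω => ∏ s ∈ Finset.range t, (if J s ω then g s (x s ω) else 1)
      with hY
    have hYm : Measurable[past x t] Y := hmeas t
    have hA : MeasurableSet {ω | J t ω} := past_le hx t _ (hJ t)
    have hYi : Measurable[past x t] ({ω | J t ω}.indicator Y) :=
      hYm.indicator (hJ t)
    have hsplit : ∀ ω, ∏ s ∈ Finset.range (t + 1), (if J s ω then g s (x s ω) else 1)
        = {ω | J t ω}.indicator Y ω * g t (x t ω) + {ω | J t ω}ᶜ.indicator Y ω := by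
      intro ω
      rw [Finset.prod_range_succ]
      by_cases h : J t ω
      · rw [if_pos h, Set.indicator_of_mem (by exact h), Set.indicator_of_notMem (by simpa using h),
          add_zero]
      · rw [if_neg h, Set.indicator_of_notMem (by exact h), Set.indicator_of_mem (by exact h),
          zero_mul, zero_add, mul_one]
    -- The new factor is independent of both the accumulated product and the decision to use it.
    have hmul := lintegral_mul_eq_lintegral_mul_lintegral_of_independent_measurableSpace
      (past_le hx t) (hx t).comap_le (indep_past hx hind t) hYi
      ((hg t).comp (comap_measurable (x t)))
    have hm1 : Measurable fun ω => {ω | J t ω}.indicator Y ω * g t (x t ω) :=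
      (hYi.mono (past_le hx t) le_rfl).mul ((hg t).comp (hx t))
    simp only [hsplit]
    rw [lintegral_add_left hm1]
    calc (∫⁻ ω, {ω | J t ω}.indicator Y ω * g t (x t ω) ∂P)
          + ∫⁻ ω, {ω | J t ω}ᶜ.indicator Y ω ∂P
        ≤ (∫⁻ ω, {ω | J t ω}.indicator Y ω ∂P) + ∫⁻ ω, {ω | J t ω}ᶜ.indicator Y ω ∂P := by
          refine add_le_add (hmul.le.trans ?_) le_rfl
          exact mul_le_of_le_one_right' (hg1 t)
      _ = ∫⁻ ω, Y ω ∂P := by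
          rw [lintegral_indicator hA, lintegral_indicator hA.compl, lintegral_add_compl _ hA]
      _ ≤ 1 := ih

/-- Hoeffding's lemma, normalised to yield the factors of a supermartingale. -/
theorem lintegral_exp_le_one [IsProbabilityMeasure P] {X : Ω → ℝ} (hX : Measurable X)
    (h01 : ∀ᵐ ω ∂P, X ω ∈ Set.Icc (0 : ℝ) 1) {m : ℝ} (hm : ∫ ω, X ω ∂P = m) (l : ℝ) :
    ∫⁻ ω, ENNReal.ofReal (Real.exp (l * (X ω - m) - l ^ 2 / 8)) ∂P ≤ 1 := by
  have h := hasSubgaussianMGF_of_mem_Icc hX.aemeasurable h01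
  rw [hm] at h
  have hint := h.integrable_exp_mul l
  have hmgf := h.mgf_le l
  have heq : ∀ ω, Real.exp (l * (X ω - m) - l ^ 2 / 8)
      = Real.exp (l * (X ω - m)) * Real.exp (-(l ^ 2 / 8)) := fun ω => by
    rw [← Real.exp_add, sub_eq_add_neg]
  simp only [heq]
  rw [← ofReal_integral_eq_lintegral_ofReal (hint.mul_const _)
    (Filter.Eventually.of_forall fun ω => by positivity), integral_mul_const]
  rw [ENNReal.ofReal_le_one]
  calc (∫ ω, Real.exp (l * (X ω - m)) ∂P) * Real.exp (-(l ^ 2 / 8))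
      ≤ Real.exp (l ^ 2 / 8) * Real.exp (-(l ^ 2 / 8)) := by
        gcongr
        refine hmgf.trans (Real.exp_le_exp.2 (le_of_eq ?_))
        push_cast
        rw [sub_zero, norm_one]
        ring
    _ = 1 := by rw [← Real.exp_add, add_neg_cancel, Real.exp_zero]

/-- Keeping the first `n` samples. -/
theorem filter_card_lt_eq {J p : ℕ → Prop} {n t N : ℕ}
    (hJ : ∀ s, J s ↔ 1 ≤ s ∧ p s ∧ ((Finset.Ico 1 s).filter p).card < n) (ht : t ≤ N)
    (hn : ((Finset.Ico 1 t).filter p).card = n) :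
    (Finset.range N).filter J = (Finset.Ico 1 t).filter p := by
  ext s
  simp only [Finset.mem_filter, Finset.mem_range, Finset.mem_Ico, hJ]
  constructor
  · rintro ⟨hsN, hs1, hps, hcard⟩
    refine ⟨⟨hs1, ?_⟩, hps⟩
    by_contra hst
    refine absurd hcard (not_lt.2 ?_)
    rw [← hn]
    exact Finset.card_le_card
      (Finset.filter_subset_filter _ (Finset.Ico_subset_Ico le_rfl (not_lt.1 hst)))
  · rintro ⟨⟨hs1, hst⟩, hps⟩
    refine ⟨by omega, hs1, hps, ?_⟩
    rw [← hn]
    refine Finset.card_lt_card (Finset.ssubset_iff_of_subset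
      (Finset.filter_subset_filter _ (Finset.Ico_subset_Ico le_rfl hst.le)) |>.2 ⟨s, ?_, ?_⟩)
    · simp [hs1, hst, hps]
    · simp

variable {K : ℕ} {x : ℕ → Ω → Fin K → ℝ} {μ : ℕ → Fin K → ℝ}

/-- All `t` with exactly `n` samples share the same sample set, so one Markov inequality, for the
product stopped after `n` samples, covers them together. The signs `c = 1` and `c = -1` give the two
tails. -/
theorem measure_sum_ge_le [IsProbabilityMeasure P] (henv : IsEnvironment P x μ) (i : Fin K)
    {p : ℕ → Ω → Prop} {n : ℕ} (hn : 1 ≤ n)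
    (hp : ∀ s, MeasurableSet[past x s]
      {ω | 1 ≤ s ∧ p s ω ∧ ((Finset.Ico 1 s).filter fun r => p r ω).card < n})
    (N : ℕ) {a : ℝ} (ha : 0 ≤ a) {c : ℝ} (hc : c ^ 2 = 1) :
    P {ω | ∃ t ≤ N, ((Finset.Ico 1 t).filter fun r => p r ω).card = n ∧
        a ≤ c * ∑ s ∈ (Finset.Ico 1 t).filter fun r => p r ω, (x s ω i - μ s i)}
      ≤ ENNReal.ofReal (Real.exp (-(2 * a ^ 2 / n))) := by
  have hn0 : (0 : ℝ) < n := by exact_mod_cast hn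
  -- `4 * a / n` maximises `l * a - n * l ^ 2 / 8`, with value `2 * a ^ 2 / n`.
  set l : ℝ := c * (4 * a / n) with hl
  have hl2 : l ^ 2 = (4 * a / n) ^ 2 := by rw [hl, mul_pow, hc, one_mul]
  set g : ℕ → (Fin K → ℝ) → ENNReal := fun s v =>
    ENNReal.ofReal (Real.exp (l * (v i - μ s i) - l ^ 2 / 8)) with hg
  have hgm : ∀ s, Measurable (g s) := fun s => by
    have : Measurable fun v : Fin K → ℝ => v i := measurable_pi_apply i
    fun_prop
  obtain ⟨J, hJ⟩ : ∃ J : ℕ → Ω → Prop, ∀ s ω, J s ω ↔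
      1 ≤ s ∧ p s ω ∧ ((Finset.Ico 1 s).filter fun r => p r ω).card < n :=
    ⟨_, fun _ _ => Iff.rfl⟩
  simp only [← hJ] at hp
  have hY := lintegral_prod_le_one henv.measurable henv.indep hgm (fun s =>
    lintegral_exp_le_one ((measurable_pi_apply i).comp (henv.measurable s)) (henv.mem_unit s i)
      (henv.mean s i) l) hp N
  have hYm : Measurable fun ω => ∏ s ∈ Finset.range N, (if J s ω then g s (x s ω) else 1) := by
    refine Finset.measurable_fun_prod _ fun s _ => ?_
    exact Measurable.ite (past_le henv.measurable s _ (hp s))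
      ((hgm s).comp (henv.measurable s)) measurable_const
  set v : ENNReal := ENNReal.ofReal (Real.exp (2 * a ^ 2 / n)) with hv
  have hv0 : v ≠ 0 := by
    rw [hv, Ne, ENNReal.ofReal_eq_zero, not_le]
    exact Real.exp_pos _
  have hmarkov := meas_ge_le_lintegral_div (μ := P) hYm.aemeasurable hv0 ENNReal.ofReal_ne_top
  refine (measure_mono ?_).trans (hmarkov.trans ?_)
  · rintro ω ⟨t, htN, hcard, hsum⟩
    change v ≤ ∏ s ∈ Finset.range N, (if J s ω then g s (x s ω) else 1)
    rw [← Finset.prod_filter, filter_card_lt_eq (fun s => hJ s ω) htN hcard, hg,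
      ← ENNReal.ofReal_prod_of_nonneg fun s _ => (Real.exp_pos _).le, ← Real.exp_sum,
      Finset.sum_sub_distrib, ← Finset.mul_sum, Finset.sum_const, hcard, nsmul_eq_mul, hv]
    refine ENNReal.ofReal_le_ofReal (Real.exp_le_exp.2 ?_)
    rw [hl2, hl]
    have h1 : 4 * a / n * a ≤ 4 * a / n *
        (c * ∑ s ∈ (Finset.Ico 1 t).filter fun r => p r ω, (x s ω i - μ s i)) :=
      mul_le_mul_of_nonneg_left hsum (by positivity)
    have h2 : 2 * a ^ 2 / n = 4 * a / n * a - n * ((4 * a / n) ^ 2 / 8) := by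
      field_simp
      ring
    rw [h2]
    linarith
  · rw [Real.exp_neg, ENNReal.ofReal_inv_of_pos (Real.exp_pos _), ← one_div]
    exact ENNReal.div_le_div_right hY _

end Concentration

/-! ### Measurability of the algorithm's state -/

section Measurability

variable {K : ℕ} (L T : ℕ)

variable {Ω : Type*} [MeasurableSpace Ω] {x : ℕ → Ω → Fin K → ℝ}

theorem measurable_upper {A : Finset ℕ} (hx : ∀ s ∈ A, Measurable (x s)) (i : Fin K) :
    Measurable fun ω => upper T (fun t => x t ω) A i := by
  unfold upper empMean
  split_ifs
  · exact measurable_const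
  · refine Measurable.coe_real_ereal (Measurable.add_const (Measurable.div_const ?_ _) _)
    exact Finset.measurable_fun_sum _ fun s hs => (measurable_pi_apply i).comp (hx s hs)

theorem measurable_lower {A : Finset ℕ} (hx : ∀ s ∈ A, Measurable (x s)) (i : Fin K) :
    Measurable fun ω => lower T (fun t => x t ω) A i := by
  unfold lower empMean
  split_ifs
  · exact measurable_const
  · refine Measurable.coe_real_ereal (Measurable.sub_const (Measurable.div_const ?_ _) _)
    exact Finset.measurable_fun_sum _ fun s hs => (measurable_pi_apply i).comp (hx s hs)

/-- A function of finitely many measurable conditions has measurable fibres. -/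
theorem measurableSet_of_forall_iff {ι : Type*} [Finite ι] {q : ι → Ω → Prop}
    (hq : ∀ a, MeasurableSet {ω | q a ω}) {β : Type*} (f : Ω → β)
    (hf : ∀ ω ω', (∀ a, q a ω ↔ q a ω') → f ω = f ω') (b : β) :
    MeasurableSet {ω | f ω = b} := by
  have hm : Measurable fun ω a => q a ω :=
    measurable_pi_lambda _ fun a => measurable_to_prop (by simpa [Set.preimage] using hq a)
  have : {ω | f ω = b} = (fun ω a => q a ω) ⁻¹' ((fun ω a => q a ω) '' {ω | f ω = b}) := by
    refine Set.Subset.antisymm (Set.subset_preimage_image _ _) ?_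
    rintro ω ⟨ω', hω', h⟩
    exact (hf ω ω' fun a => (congrFun h a).symm.to_iff).trans hω'
  rw [this]
  exact hm (Set.Finite.measurableSet (Set.toFinite _))

variable [NeZero K] (tie : TieRule K)

/-- Countably many reachable states reduce every event about the state to single fibres, with no
σ-algebra on `State K`. -/
theorem countable_range_baseState (t : ℕ) :
    (Set.range fun x => baseState L T tie x t).Countable := by
  induction t with
  | zero => exact (Set.countable_singleton _).mono (Set.range_subset_iff.2 fun x => rfl)
  | succ t ih =>
    refine ((ih.prod (Set.countable_univ (α := Finset (Fin K) × Finset (Fin K)))).image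
      fun q => ({ start := q.1.start, sel := Function.update q.1.sel (t + 1) q.2.1,
                  cand := q.2.2 } : State K)).mono ?_
    rintro _ ⟨x, rfl⟩
    simp only [baseState_succ]
    exact ⟨(baseState L T tie x t, _, _), ⟨⟨x, rfl⟩, Set.mem_univ _⟩, rfl⟩

/-- Rewards enter only through finitely many comparisons of indices, so an arbitrary tie rule does
no harm. -/
theorem measurableSet_select {t : ℕ} (hx : ∀ s < t, Measurable (x s)) (σ : State K)
    (A : Finset (Fin K)) : MeasurableSet {ω | select L T tie (fun s => x s ω) t σ = A} := by
  set U : Fin K → Ω → EReal := fun i ω =>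
    upper T (fun s => x s ω) (samples σ.sel (Finset.Ico σ.start t) i) i with hU
  have hUm : ∀ i, Measurable (U i) := fun i => measurable_upper T (fun s hs => hx s
    (Finset.mem_Ico.1 (Finset.mem_filter.1 hs).1).2) i
  refine measurableSet_of_forall_iff (q := fun (a : Fin K × Fin K) ω => U a.1 ω ≤ U a.2 ω)
    (fun a => measurableSet_le (hUm _) (hUm _)) _ (fun ω ω' h => ?_) A
  have htop : ∀ avail m, topSets (fun i => U i ω) avail m = topSets (fun i => U i ω') avail m :=
    fun avail m => Finset.filter_congr fun B _ =>
      forall₂_congr fun i _ => forall₂_congr fun j _ => h (j, i)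
  unfold select
  change (if _ then insert _ (tie.pick t σ (topSets (fun i => U i ω) _ _))
    else tie.pick t σ (topSets (fun i => U i ω) _ _)) = _
  rw [htop, htop]

theorem measurableSet_eliminate {t : ℕ} (hx : ∀ s < t, Measurable (x s)) (σ : State K)
    (A : Finset (Fin K)) : MeasurableSet {ω | eliminate T (fun s => x s ω) t σ = A} := by
  have hs : ∀ i, ∀ s ∈ samplesE σ.sel (Finset.Ico σ.start t) i, Measurable (x s) :=
    fun i s hs => hx s (Finset.mem_Ico.1 (Finset.mem_filter.1 hs).1).2
  refine measurableSet_of_forall_iff (q := fun (i : Fin K) ω =>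
      upper T (fun s => x s ω) (samplesE σ.sel (Finset.Ico σ.start t) (arm K t)) (arm K t)
        < lower T (fun s => x s ω) (samplesE σ.sel (Finset.Ico σ.start t) i) i)
    (fun i => measurableSet_lt (measurable_upper T (hs _) _) (measurable_lower T (hs _) _)) _
    (fun ω ω' h => ?_) A
  unfold eliminate
  simp only [h]

/-- Only rewards before round `t` need be measurable, so the σ-algebra may be `past x t`: the state,
including the selection of round `t`, is predictable. -/
theorem measurableSet_baseState {t : ℕ} (hx : ∀ s < t, Measurable (x s)) (q : State K → Prop) :
    MeasurableSet {ω | q (baseState L T tie (fun s => x s ω) t)} := by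
  have hcount : ∀ t, (Set.range fun ω => baseState L T tie (fun s => x s ω) t).Countable :=
    fun t => (countable_range_baseState L T tie t).mono
      (Set.range_subset_iff.2 fun ω =>
        Set.mem_range_self (f := fun x => baseState L T tie x t) fun s => x s ω)
  suffices h : ∀ σ, MeasurableSet {ω | baseState L T tie (fun s => x s ω) t = σ} by
    have : {ω | q (baseState L T tie (fun s => x s ω) t)} =
        ⋃ σ ∈ (Set.range fun ω => baseState L T tie (fun s => x s ω) t) ∩ {σ | q σ},
          {ω | baseState L T tie (fun s => x s ω) t = σ} := by
      ext ω
      rw [Set.mem_iUnion₂]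
      constructor
      · exact fun h => ⟨baseState L T tie (fun s => x s ω) t, ⟨⟨ω, rfl⟩, h⟩, rfl⟩
      · rintro ⟨σ, ⟨_, h⟩, rfl⟩
        exact h
    rw [this]
    exact MeasurableSet.biUnion ((hcount t).mono Set.inter_subset_left) fun σ _ => h σ
  clear q
  induction t with
  | zero =>
    exact fun σ => MeasurableSet.const (({ start := 1, sel := fun _ => ∅, cand := Finset.univ }
      : State K) = σ)
  | succ t ih =>
    intro σ
    have : {ω | baseState L T tie (fun s => x s ω) (t + 1) = σ} =
        ⋃ ρ ∈ Set.range fun ω => baseState L T tie (fun s => x s ω) t,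
          {ω | baseState L T tie (fun s => x s ω) t = ρ} ∩
          ⋃ A, ⋃ C, {ω | select L T tie (fun s => x s ω) (t + 1) ρ = A} ∩
            {ω | eliminate T (fun s => x s ω) (t + 1) ρ = C} ∩
            {_ω | ({ start := ρ.start, sel := Function.update ρ.sel (t + 1) A, cand := C }
              : State K) = σ} := by
      ext ω
      simp only [baseState_succ, Set.mem_ofPred_eq, Set.mem_iUnion, exists_prop, Set.mem_inter_iff]
      constructor
      · exact fun h => ⟨_, ⟨ω, rfl⟩, rfl, _, _, ⟨rfl, rfl⟩, h⟩
      · rintro ⟨ρ, -, rfl, A, C, ⟨rfl, rfl⟩, h⟩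
        exact h
    rw [this]
    refine MeasurableSet.biUnion (hcount t) fun ρ _ =>
      (ih (fun s hs => hx s (by omega)) ρ).inter (MeasurableSet.iUnion fun A =>
        MeasurableSet.iUnion fun C => ((measurableSet_select L T tie hx ρ A).inter
          (measurableSet_eliminate T hx ρ C)).inter (MeasurableSet.const _))

end Measurability

/-! ### Summation over rounds and samples -/

section Sums

theorem sum_sqrt_div_le {a : ℝ} (ha : 0 ≤ a) (n : ℕ) :
    ∑ m ∈ Finset.range n, √(a / (m + 1)) ≤ 2 * √(a * n) := by
  induction n with
  | zero => simp
  | succ n ih =>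
    rw [Finset.sum_range_succ]
    have hn : (0 : ℝ) < n + 1 := by positivity
    have h1 : √(a / (n + 1)) = √a / √(n + 1) := Real.sqrt_div ha _
    have h2 : √(a * (n + 1 : ℕ)) = √a * √(n + 1) := by push_cast; exact Real.sqrt_mul ha _
    have h3 : √(a * n) = √a * √n := Real.sqrt_mul ha _
    have h4 : 1 / √((n : ℝ) + 1) ≤ 2 * √((n : ℝ) + 1) - 2 * √n := by
      have h5 := Real.sqrt_pos.2 hn
      have h6 := Real.mul_self_sqrt hn.le
      have h7 := Real.mul_self_sqrt (Nat.cast_nonneg (α := ℝ) n)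
      rw [div_le_iff₀ h5]
      nlinarith [sq_nonneg (√((n : ℝ) + 1) - √n)]
    rw [h1, h2]
    rw [h3] at ih
    have h8 := mul_le_mul_of_nonneg_left h4 (Real.sqrt_nonneg a)
    rw [mul_one_div] at h8
    linarith

/-- A term passes the threshold only if `m + 1 ≤ a / d ^ 2`, so at most `⌊a / d ^ 2⌋₊` terms remain.
-/
theorem sum_sqrt_div_threshold_le {a d : ℝ} (ha : 0 ≤ a) (hd : 0 < d) (n : ℕ) :
    ∑ m ∈ Finset.range n, (if d ≤ √(a / (m + 1)) then √(a / (m + 1)) else 0) ≤ 2 * (a / d) := by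
  rw [← Finset.sum_filter]
  calc ∑ m ∈ (Finset.range n).filter (fun m : ℕ => d ≤ √(a / (m + 1))), √(a / (m + 1))
      ≤ ∑ m ∈ Finset.range ⌊a / d ^ 2⌋₊, √(a / (m + 1)) := by
        refine Finset.sum_le_sum_of_subset_of_nonneg (fun m hm => ?_)
          fun m _ _ => Real.sqrt_nonneg _
        have h := (Finset.mem_filter.1 hm).2
        rw [Real.le_sqrt' hd, le_div_iff₀ (by positivity)] at h
        rw [Finset.mem_range, Nat.lt_iff_add_one_le, Nat.le_floor_iff (by positivity),
          le_div_iff₀ (by positivity)]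
        push_cast
        linarith
    _ ≤ 2 * √(a * ⌊a / d ^ 2⌋₊) := sum_sqrt_div_le ha _
    _ ≤ 2 * (a / d) := by
        refine mul_le_mul_of_nonneg_left (Real.sqrt_le_iff.2 ⟨by positivity, ?_⟩) two_pos.le
        calc a * (⌊a / d ^ 2⌋₊ : ℝ) ≤ a * (a / d ^ 2) :=
              mul_le_mul_of_nonneg_left (Nat.floor_le (by positivity)) ha
          _ = (a / d) ^ 2 := by ring

variable {K : ℕ}

/-- Equal cardinalities give a bijection of `I \ A` with `A \ I`. The exceptional arm `k` is matched
at most once, so its bound `ψ` is paid once rather than once per selected arm. -/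
theorem sum_sub_sum_le {A I : Finset (Fin K)} (hcard : A.card = I.card) {f φ : Fin K → ℝ} {ψ : ℝ}
    (k : Fin K) (hφ : ∀ i, 0 ≤ φ i) (hψ : 0 ≤ ψ)
    (h : ∀ i ∈ I \ A, ∀ j ∈ A \ I, (i = k ∧ f j - f i ≤ ψ) ∨ f j - f i ≤ φ i) :
    ∑ i ∈ A, f i - ∑ i ∈ I, f i ≤ ∑ i ∈ I, φ i + ψ := by
  have hcard' : (I \ A).card = (A \ I).card := (Finset.card_sdiff_comm hcard).symm
  let e := Finset.equivOfCardEq hcard'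
  have h1 : ∑ j ∈ A \ I, f j = ∑ i ∈ (I \ A).attach, f (e i) := by
    rw [← Finset.sum_attach]
    exact (Equiv.sum_comp e fun j : { j // j ∈ A \ I } => f j).symm
  have h2 : ∑ i ∈ A, f i - ∑ i ∈ I, f i = ∑ j ∈ A \ I, f j - ∑ i ∈ I \ A, f i := by
    have h3 := Finset.sum_inter_add_sum_sdiff A I f
    have h4 := Finset.sum_inter_add_sum_sdiff I A f
    rw [Finset.inter_comm] at h4
    linarith
  rw [h2, h1, ← Finset.sum_attach (I \ A), ← Finset.sum_sub_distrib]
  calc ∑ i ∈ (I \ A).attach, (f (e i) - f i)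
      ≤ ∑ i ∈ (I \ A).attach, (φ i + if (i : Fin K) = k then ψ else 0) := by
        refine Finset.sum_le_sum fun i _ => ?_
        have hi := hφ i
        rcases h i i.2 (e i) (e i).2 with ⟨hk, h⟩ | h
        · rw [if_pos hk]
          linarith
        · split_ifs <;> linarith
    _ = ∑ i ∈ I \ A, (φ i + if i = k then ψ else 0) :=
        Finset.sum_attach (I \ A) fun i => φ i + if i = k then ψ else 0
    _ ≤ ∑ i ∈ I, (φ i + if i = k then ψ else 0) := by
        refine Finset.sum_le_sum_of_subset_of_nonneg Finset.sdiff_subset fun i _ _ => ?_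
        have hi := hφ i
        split_ifs <;> linarith
    _ ≤ ∑ i ∈ I, φ i + ψ := by
        rw [Finset.sum_add_distrib, Finset.sum_ite_eq']
        split_ifs <;> linarith

theorem exists_bestValue {L : ℕ} (hLK : L ≤ K) (μ : ℕ → Fin K → ℝ) (t : ℕ) :
    ∃ A : Finset (Fin K), A.card = L ∧ bestValue L μ t = ∑ i ∈ A, μ t i := by
  have hfin : {r | ∃ A : Finset (Fin K), A.card = L ∧ r = ∑ i ∈ A, μ t i}.Finite :=
    (Set.finite_range fun A : Finset (Fin K) => ∑ i ∈ A, μ t i).subset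
      fun r ⟨A, _, hr⟩ => ⟨A, hr.symm⟩
  have hne : {r | ∃ A : Finset (Fin K), A.card = L ∧ r = ∑ i ∈ A, μ t i}.Nonempty := by
    obtain ⟨A, -, hA⟩ := Finset.exists_subset_card_eq (s := (Finset.univ : Finset (Fin K)))
      (n := L) (by simpa using hLK)
    exact ⟨_, A, hA, rfl⟩
  exact hne.csSup_mem hfin

theorem Reg_eq_sum_range (L : ℕ) (μ : ℕ → Fin K → ℝ) (I : ℕ → Finset (Fin K)) (S : ℕ) :
    Reg L μ I S = ∑ t ∈ Finset.range S, reg L μ I (t + 1) := by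
  rw [Reg, Finset.range_eq_Ico, Finset.sum_Ico_add' (reg L μ I) 0 S 1, zero_add]
  rfl

theorem card_samples_succ (I : ℕ → Finset (Fin K)) (t : ℕ) (i : Fin K) :
    (samples I (Finset.Ico 1 (t + 1 + 1)) i).card
      = (samples I (Finset.Ico 1 (t + 1)) i).card + if i ∈ I (t + 1) then 1 else 0 := by
  rw [samples, samples, ← Finset.insert_Ico_right_eq_Ico_add_one (by omega : 1 ≤ t + 1),
    Finset.filter_insert]
  split_ifs
  · rw [Finset.card_insert_of_notMem (by simp)]
  · rfl

/-- Summing a function of the number of earlier samples over all selections. -/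
theorem sum_samples (I : ℕ → Finset (Fin K)) (h : ℕ → ℝ) (S : ℕ) :
    ∑ t ∈ Finset.range S, ∑ i ∈ I (t + 1), h (samples I (Finset.Ico 1 (t + 1)) i).card
      = ∑ i, ∑ m ∈ Finset.range (samples I (Finset.Ico 1 (S + 1)) i).card, h m := by
  induction S with
  | zero => simp [samples]
  | succ S ih =>
    rw [Finset.sum_range_succ, ih,
      ← Finset.sum_filter_add_sum_filter_not Finset.univ (· ∈ I (S + 1)),
      ← Finset.sum_filter_add_sum_filter_not Finset.univ (· ∈ I (S + 1)) fun i =>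
        ∑ m ∈ Finset.range (samples I (Finset.Ico 1 (S + 1 + 1)) i).card, h m]
    have h1 : ∑ i ∈ Finset.univ.filter (· ∈ I (S + 1)),
        ∑ m ∈ Finset.range (samples I (Finset.Ico 1 (S + 1 + 1)) i).card, h m
        = ∑ i ∈ Finset.univ.filter (· ∈ I (S + 1)),
          ∑ m ∈ Finset.range (samples I (Finset.Ico 1 (S + 1)) i).card, h m
          + ∑ i ∈ I (S + 1), h (samples I (Finset.Ico 1 (S + 1)) i).card := by
      rw [Finset.filter_univ_mem, ← Finset.sum_add_distrib]
      refine Finset.sum_congr rfl fun i hi => ?_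
      rw [card_samples_succ, if_pos hi, Finset.sum_range_succ]
    have h2 : ∑ i ∈ Finset.univ.filter (¬ · ∈ I (S + 1)),
        ∑ m ∈ Finset.range (samples I (Finset.Ico 1 (S + 1 + 1)) i).card, h m
        = ∑ i ∈ Finset.univ.filter (¬ · ∈ I (S + 1)),
          ∑ m ∈ Finset.range (samples I (Finset.Ico 1 (S + 1)) i).card, h m := by
      refine Finset.sum_congr rfl fun i hi => ?_
      rw [card_samples_succ, if_neg (Finset.mem_filter.1 hi).2, add_zero]
    rw [h1, h2]
    ring

end Sums

/-! ### Regret on the concentration event -/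

section Regret

variable {K : ℕ} [NeZero K] {L T : ℕ} {tie : TieRule K} {x : ℕ → Fin K → ℝ}

theorem abs_reg_le (hL : 1 ≤ L) (hLK : L ≤ K) {μ : ℕ → Fin K → ℝ}
    (hμ : ∀ s i, μ s i ∈ Set.Icc (0 : ℝ) 1) (t : ℕ) :
    |reg L μ (elimUCB L T tie x) (t + 1)| ≤ L := by
  obtain ⟨A, hA, hbest⟩ := exists_bestValue hLK μ (t + 1)
  have hI := (elimUCB_succ_spec T tie x hL hLK t).1
  have hb : ∀ B : Finset (Fin K), B.card = L →
      0 ≤ ∑ i ∈ B, μ (t + 1) i ∧ ∑ i ∈ B, μ (t + 1) i ≤ L := fun B hB =>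
    ⟨Finset.sum_nonneg fun i _ => (hμ _ i).1, by
      have := Finset.sum_le_card_nsmul B (μ (t + 1)) 1 fun i _ => (hμ _ i).2
      rwa [hB, nsmul_eq_mul, mul_one] at this⟩
  rw [reg, hbest, abs_le]
  have h1 := hb A hA
  have h2 := hb _ hI
  constructor <;> linarith

theorem abs_Reg_le (hL : 1 ≤ L) (hLK : L ≤ K) {μ : ℕ → Fin K → ℝ}
    (hμ : ∀ s i, μ s i ∈ Set.Icc (0 : ℝ) 1) (S : ℕ) :
    |Reg L μ (elimUCB L T tie x) S| ≤ L * S := by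
  rw [Reg_eq_sum_range]
  calc |∑ t ∈ Finset.range S, reg L μ (elimUCB L T tie x) (t + 1)|
      ≤ ∑ t ∈ Finset.range S, |reg L μ (elimUCB L T tie x) (t + 1)| :=
        Finset.abs_sum_le_sum_abs _ _
    _ ≤ ∑ _t ∈ Finset.range S, (L : ℝ) := Finset.sum_le_sum fun t _ => abs_reg_le hL hLK hμ t
    _ = L * S := by rw [Finset.sum_const, Finset.card_range, nsmul_eq_mul, mul_comm]

/-- Cauchy-Schwarz over the `K` arms, whose sample counts add up to `L * S`. -/
theorem sum_sqrt_samples_le (hL : 1 ≤ L) (hLK : L ≤ K) {a : ℝ} (ha : 0 ≤ a) (S : ℕ) :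
    ∑ t ∈ Finset.range S, ∑ i ∈ elimUCB L T tie x (t + 1),
      √(a / ((samples (elimUCB L T tie x) (Finset.Ico 1 (t + 1)) i).card + 1))
      ≤ 2 * √(a * (L * K * S)) := by
  set I := elimUCB L T tie x with hI
  have hcount : ∑ i, ((samples I (Finset.Ico 1 (S + 1)) i).card : ℝ) = L * S := by
    have h := sum_samples I (fun _ => 1) S
    simp only [Finset.sum_const, nsmul_eq_mul, mul_one, Finset.card_range] at h
    rw [← h]
    have : ∀ t ∈ Finset.range S, ((I (t + 1)).card : ℝ) = L := fun t _ => by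
      rw [hI, (elimUCB_succ_spec T tie x hL hLK t).1]
    rw [Finset.sum_congr rfl this, Finset.sum_const, Finset.card_range, nsmul_eq_mul, mul_comm]
  rw [sum_samples I (fun m => √(a / (m + 1)))]
  calc ∑ i, ∑ m ∈ Finset.range (samples I (Finset.Ico 1 (S + 1)) i).card, √(a / (m + 1))
      ≤ ∑ i, 2 * √(a * (samples I (Finset.Ico 1 (S + 1)) i).card) :=
        Finset.sum_le_sum fun i _ => sum_sqrt_div_le ha _
    _ = 2 * ∑ i, √(a * (samples I (Finset.Ico 1 (S + 1)) i).card) := by rw [Finset.mul_sum]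
    _ ≤ 2 * √(a * (L * K * S)) := by
        refine mul_le_mul_of_nonneg_left (Real.le_sqrt_of_sq_le ?_) two_pos.le
        refine sq_sum_le_card_mul_sum_sq.trans (le_of_eq ?_)
        have : ∀ i : Fin K, √(a * (samples I (Finset.Ico 1 (S + 1)) i).card) ^ 2
            = a * (samples I (Finset.Ico 1 (S + 1)) i).card := fun i =>
          Real.sq_sqrt (by positivity)
        simp only [this]
        rw [← Finset.mul_sum, hcount, Finset.card_univ, Fintype.card_fin]
        ring

/-- The drift-tolerant regret bound on the event that the empirical means concentrate. -/
theorem Reg_le_of_concentrated (hL : 1 ≤ L) (hLK : L ≤ K) (hT : 2 ≤ T) {μ : ℕ → Fin K → ℝ}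
    (hμ : ∀ s i, μ s i ∈ Set.Icc (0 : ℝ) 1)
    (hc : Concentrated T x μ (elimUCB L T tie x)) {S : ℕ} (hS : S ≤ T) :
    Reg L μ (elimUCB L T tie x) S ≤ 102 * Real.log T ^ 1 * √((L : ℝ) * K * S)
      + 102 * L * ∑ t ∈ Finset.Icc 1 S, drift μ t := by
  set I := elimUCB L T tie x with hI
  have hlog := two_thirds_le_log hT
  have hL' : (1 : ℝ) ≤ L := by exact_mod_cast hL
  have hround : ∀ t ∈ Finset.range S, reg L μ I (t + 1) ≤
      ∑ i ∈ I (t + 1), √(16 * Real.log T / ((samples I (Finset.Ico 1 (t + 1)) i).card + 1))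
        + √(96 * K * Real.log T / (t + 1)) + 102 * L * drift μ (t + 1) := by
    intro t ht
    have ht' : t < T := (Finset.mem_range.1 ht).trans_le hS
    obtain ⟨A, hA, hbest⟩ := exists_bestValue hLK μ (t + 1)
    have hIcard := (elimUCB_succ_spec T tie x hL hLK t).1
    have hD := drift_nonneg μ (t + 1)
    have h := sum_sub_sum_le (hA.trans hIcard.symm) (f := μ (t + 1))
      (φ := fun i => 2 * drift μ (t + 1)
        + √(16 * Real.log T / ((samples I (Finset.Ico 1 (t + 1)) i).card + 1)))
      (ψ := 100 * drift μ (t + 1) + √(96 * K * Real.log T / (t + 1))) (arm K (t + 1))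
      (fun i => by positivity) (by positivity) fun i hi j hj =>
        gap_le hL hLK hT hμ hc ht' (Finset.mem_sdiff.1 hi).1 (Finset.mem_sdiff.1 hj).2
    rw [Finset.sum_add_distrib, Finset.sum_const, hIcard, nsmul_eq_mul] at h
    rw [reg, hbest]
    refine h.trans ?_
    have : 100 * drift μ (t + 1) ≤ 100 * L * drift μ (t + 1) := by nlinarith
    linarith
  rw [Reg_eq_sum_range]
  refine (Finset.sum_le_sum hround).trans ?_
  rw [Finset.sum_add_distrib, Finset.sum_add_distrib, ← Finset.mul_sum]
  have h1 : ∑ t ∈ Finset.range S, drift μ (t + 1) = ∑ t ∈ Finset.Icc 1 S, drift μ t := by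
    rw [Finset.range_eq_Ico, Finset.sum_Ico_add' (drift μ) 0 S 1, zero_add]
    rfl
  have h2 := sum_sqrt_samples_le (T := T) (tie := tie) (x := x) hL hLK
    (a := 16 * Real.log T) (by positivity) S
  have h3 := sum_sqrt_div_le (a := 96 * K * Real.log T) (by positivity) S
  -- Since `2 / 3 ≤ log T`, the factor `√(log T)` can be traded for `log T`; hence the exponent `1`.
  have h4 : ∀ c d : ℝ, 0 ≤ c → 0 ≤ d → 3 * c ≤ 2 * d ^ 2 →
      √(c * Real.log T * (L * K * S)) ≤ d * Real.log T * √((L : ℝ) * K * S) := by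
    intro c d hc hd hcd
    rw [Real.sqrt_mul (by positivity)]
    refine mul_le_mul_of_nonneg_right (Real.sqrt_le_iff.2 ⟨by positivity, ?_⟩) (Real.sqrt_nonneg _)
    nlinarith [mul_nonneg (sq_nonneg d) (by linarith : (0 : ℝ) ≤ Real.log T)]
  have h5 := h4 16 5 (by norm_num) (by norm_num) (by norm_num)
  have h6 := h4 96 12 (by norm_num) (by norm_num) (by norm_num)
  have h7 : √(96 * K * Real.log T * S) ≤ √(96 * Real.log T * (L * K * S)) := by
    apply Real.sqrt_le_sqrt
    have : 0 ≤ 96 * K * Real.log T * S := by positivity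
    nlinarith
  have h8 : 0 ≤ Real.log T * √((L : ℝ) * K * S) := by positivity
  rw [h1, pow_one]
  linarith

/-- The distribution-dependent regret bound on the event that the empirical means concentrate. -/
theorem Reg_le_of_concentrated_of_gap (hL : 1 ≤ L) (hT : 2 ≤ T) {m : Fin K → ℝ}
    (hm : ∀ i, m i ∈ Set.Icc (0 : ℝ) 1) {A : Finset (Fin K)} (hA : A.card = L) {d : ℝ}
    (hd : 0 < d) (hgap : ∀ j ∈ A, ∀ i ∉ A, d ≤ m j - m i)
    (hc : Concentrated T x (fun _ => m) (elimUCB L T tie x)) :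
    Reg L (fun _ => m) (elimUCB L T tie x) T ≤ 224 * (K * Real.log T / d) := by
  have hLK : L ≤ K := by simpa [hA] using Finset.card_le_univ A
  set I := elimUCB L T tie x with hI
  have hlog := two_thirds_le_log hT
  have hround : ∀ t ∈ Finset.range T, reg L (fun _ => m) I (t + 1) ≤
      ∑ i ∈ I (t + 1),
        (if d ≤ √(16 * Real.log T / ((samples I (Finset.Ico 1 (t + 1)) i).card + 1))
          then √(16 * Real.log T / ((samples I (Finset.Ico 1 (t + 1)) i).card + 1)) else 0)
        + if d ≤ √(96 * K * Real.log T / (t + 1)) then √(96 * K * Real.log T / (t + 1)) else 0 := by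
    intro t ht
    obtain ⟨A', hA', hbest⟩ := exists_bestValue hLK (fun _ => m) (t + 1)
    have hIcard := (elimUCB_succ_spec T tie x hL hLK t).1
    have hopt : ∑ i ∈ A', m i ≤ ∑ i ∈ A, m i := by
      have := sum_sub_sum_le (hA'.trans hA.symm) (f := m) (φ := fun _ => 0) (ψ := 0)
        (arm K 0) (fun _ => le_rfl) le_rfl fun i hi j hj => Or.inr (by
          have := hgap i (Finset.mem_sdiff.1 hi).1 j (Finset.mem_sdiff.1 hj).2
          linarith)
      simp only [Finset.sum_const_zero, add_zero] at this
      linarith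
    -- Every paired gap is at least `d`, so bounds below `d` never apply and may be replaced by
    -- zero.
    have h := sum_sub_sum_le (hA.trans hIcard.symm) (f := m)
      (φ := fun i => if d ≤ √(16 * Real.log T / ((samples I (Finset.Ico 1 (t + 1)) i).card + 1))
          then √(16 * Real.log T / ((samples I (Finset.Ico 1 (t + 1)) i).card + 1)) else 0)
      (ψ := if d ≤ √(96 * K * Real.log T / (t + 1)) then √(96 * K * Real.log T / (t + 1)) else 0)
      (arm K (t + 1)) (fun i => by split_ifs <;> positivity) (by split_ifs <;> positivity)
      fun i hi j hj => by
        have hi' := Finset.mem_sdiff.1 hi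
        have hj' := Finset.mem_sdiff.1 hj
        have h1 := hgap j hj'.1 i hi'.2
        have h2 := gap_le (μ := fun _ => m) hL hLK hT (fun _ => hm) hc (Finset.mem_range.1 ht)
          hi'.1 hj'.2
        simp only [drift_const, mul_zero, zero_add] at h2
        rcases h2 with ⟨hk, h2⟩ | h2
        · exact Or.inl ⟨hk, by rwa [if_pos (h1.trans h2)]⟩
        · exact Or.inr (by rwa [if_pos (h1.trans h2)])
    rw [reg, hbest]
    linarith
  rw [Reg_eq_sum_range]
  refine (Finset.sum_le_sum hround).trans ?_
  rw [Finset.sum_add_distrib, sum_samples I (fun n => if d ≤ √(16 * Real.log T / (n + 1))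
    then √(16 * Real.log T / (n + 1)) else 0)]
  have h1 : ∀ i : Fin K, i ∈ Finset.univ → _ ≤ _ := fun i _ =>
    sum_sqrt_div_threshold_le (a := 16 * Real.log T) (by positivity) hd
      (samples I (Finset.Ico 1 (T + 1)) i).card
  have h2 := sum_sqrt_div_threshold_le (a := 96 * K * Real.log T) (by positivity) hd T
  have h3 := Finset.sum_le_sum h1
  rw [Finset.sum_const, Finset.card_univ, Fintype.card_fin, nsmul_eq_mul] at h3
  -- `224 = 2 * 16 + 2 * 96`: selections by index plus turns of candidates.
  refine (add_le_add h3 h2).trans (le_of_eq ?_)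
  ring

end Regret

/-! ### Predictability of the sampling decisions -/

section Sampling

variable {Ω : Type*} {K : ℕ} [NeZero K] (L T : ℕ) (tie : TieRule K)

theorem measurableSet_elimUCB [MeasurableSpace Ω] {x : ℕ → Ω → Fin K → ℝ} {t : ℕ}
    (hx : ∀ s < t, Measurable (x s)) {q : (ℕ → Finset (Fin K)) → Prop}
    (hq : ∀ I I', (∀ s ≤ t, I s = I' s) → (q I ↔ q I')) :
    MeasurableSet {ω | q (elimUCB L T tie fun s => x s ω)} := by
  have h := measurableSet_baseState L T tie hx fun σ => q σ.sel
  convert h using 3 with ω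
  exact hq _ _ fun s hs =>
    (stateAfter_sel_of_le L T tie (noReset K) (fun s => x s ω) hs).symm

theorem measurableSet_sampling (x : ℕ → Ω → Fin K → ℝ) (q : ℕ → Finset (Fin K) → Prop) (n s : ℕ) :
    MeasurableSet[past x s] {ω | 1 ≤ s ∧ q s (elimUCB L T tie (fun s => x s ω) s) ∧
      ((Finset.Ico 1 s).filter
        fun r => q r (elimUCB L T tie (fun s => x s ω) r)).card < n} := by
  refine @measurableSet_elimUCB Ω K _ L T tie (past x s) x s
    (fun r hr => (comap_measurable (x r)).mono (comap_le_past x hr) le_rfl)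
    (fun I => 1 ≤ s ∧ q s (I s) ∧ ((Finset.Ico 1 s).filter fun r => q r (I r)).card < n)
    fun I I' h => ?_
  have h1 : ((Finset.Ico 1 s).filter fun r => q r (I r))
      = (Finset.Ico 1 s).filter fun r => q r (I' r) :=
    Finset.filter_congr fun r hr => by rw [h r (Finset.mem_Ico.1 hr).2.le]
  rw [h s le_rfl, h1]

end Sampling

theorem le_abs_sum_of_lt_abs_empMean {K : ℕ} {x μ : ℕ → Fin K → ℝ} {A : Finset ℕ} (hA : A ≠ ∅)
    {i : Fin K} {c : ℝ} (h : c < |empMean x A i - empMean μ A i|) :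
    c * A.card ≤ |∑ s ∈ A, (x s i - μ s i)| := by
  have hc : (0 : ℝ) < A.card := by
    exact_mod_cast Finset.card_pos.2 (Finset.nonempty_iff_ne_empty.2 hA)
  rw [empMean, empMean, ← sub_div, ← Finset.sum_sub_distrib, abs_div, abs_of_pos hc,
    lt_div_iff₀ hc] at h
  exact h.le

/-! ### Probability of concentration and expected regret -/

section Probability

variable {Ω : Type*} [MeasurableSpace Ω] {P : Measure Ω} [IsProbabilityMeasure P] {K : ℕ}
  {x : ℕ → Ω → Fin K → ℝ} {μ : ℕ → Fin K → ℝ}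

theorem IsEnvironment.mean_mem_Icc (henv : IsEnvironment P x μ) (t : ℕ) (i : Fin K) :
    μ t i ∈ Set.Icc (0 : ℝ) 1 := by
  rw [← henv.mean t i]
  refine ⟨integral_nonneg_of_ae ((henv.mem_unit t i).mono fun ω h => h.1), ?_⟩
  have h := integral_mono_of_nonneg ((henv.mem_unit t i).mono fun ω h => h.1)
    (integrable_const (1 : ℝ)) ((henv.mem_unit t i).mono fun ω h => h.2)
  simpa using h

theorem measure_abs_sum_ge_le (henv : IsEnvironment P x μ) (i : Fin K)
    {p : ℕ → Ω → Prop} {n : ℕ} (hn : 1 ≤ n)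
    (hp : ∀ s, MeasurableSet[past x s]
      {ω | 1 ≤ s ∧ p s ω ∧ ((Finset.Ico 1 s).filter fun r => p r ω).card < n})
    (N : ℕ) {a : ℝ} (ha : 0 ≤ a) :
    P {ω | ∃ t ≤ N, ((Finset.Ico 1 t).filter fun r => p r ω).card = n ∧
        a ≤ |∑ s ∈ (Finset.Ico 1 t).filter fun r => p r ω, (x s ω i - μ s i)|}
      ≤ 2 * ENNReal.ofReal (Real.exp (-(2 * a ^ 2 / n))) := by
  have h1 := measure_sum_ge_le henv i hn hp N ha (c := 1) (by norm_num)
  have h2 := measure_sum_ge_le henv i hn hp N ha (c := -1) (by norm_num)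
  rw [two_mul]
  refine (measure_mono ?_).trans ((measure_union_le _ _).trans (add_le_add h1 h2))
  rintro ω ⟨t, ht, hcard, h⟩
  rcases le_abs.1 h with h | h
  · exact Or.inl ⟨t, ht, hcard, by rwa [one_mul]⟩
  · exact Or.inr ⟨t, ht, hcard, by rwa [neg_one_mul]⟩

/-- The factor `√3 / 2` makes the exponent `3 * log T`, small enough for a union over `T` sample
sizes. -/
theorem measure_radius_le_abs_sum_le (henv : IsEnvironment P x μ) (i : Fin K)
    {p : ℕ → Ω → Prop} {T n : ℕ} (hT : 1 ≤ T) (hn : 1 ≤ n)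
    (hp : ∀ s, MeasurableSet[past x s]
      {ω | 1 ≤ s ∧ p s ω ∧ ((Finset.Ico 1 s).filter fun r => p r ω).card < n}) :
    P {ω | ∃ t ≤ T, ((Finset.Ico 1 t).filter fun r => p r ω).card = n ∧
        √3 / 2 * radius T n * n
          ≤ |∑ s ∈ (Finset.Ico 1 t).filter fun r => p r ω, (x s ω i - μ s i)|}
      ≤ ENNReal.ofReal (2 / T ^ 3) := by
  have hn' : (0 : ℝ) < n := by exact_mod_cast hn
  have hT' : (0 : ℝ) < T := by exact_mod_cast hT
  have hr := radius_nonneg T n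
  refine (measure_abs_sum_ge_le henv i hn hp T (by positivity)).trans (le_of_eq ?_)
  have h1 : 2 * (√3 / 2 * radius T n * n) ^ 2 / n = 3 * Real.log T := by
    rw [mul_pow, mul_pow, radius_eq, Real.sq_sqrt (by have := log_natCast_nonneg T; positivity),
      div_pow, Real.sq_sqrt (by norm_num)]
    field_simp
  rw [h1, show -(3 * Real.log T) = Real.log ((T : ℝ) ^ 3)⁻¹ by
      rw [Real.log_inv, Real.log_pow]; norm_num,
    Real.exp_log (by positivity), div_eq_mul_inv, ENNReal.ofReal_mul two_pos.le]
  norm_num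

variable [NeZero K] (L T : ℕ) (tie : TieRule K)

theorem measure_not_concentrated_le (henv : IsEnvironment P x μ) (hT : 1 ≤ T) :
    P {ω | ¬ Concentrated T (fun t => x t ω) μ (elimUCB L T tie fun t => x t ω)}
      ≤ ENNReal.ofReal (4 * K / T ^ 2) := by
  have hT' : (0 : ℝ) < T := by exact_mod_cast hT
  set B : (ℕ → Ω → Prop) → Fin K → ℕ → Set Ω := fun p i n =>
    {ω | ∃ t ≤ T, ((Finset.Ico 1 t).filter fun r => p r ω).card = n ∧
        √3 / 2 * radius T n * n
          ≤ |∑ s ∈ (Finset.Ico 1 t).filter fun r => p r ω, (x s ω i - μ s i)|} with hB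
  set p : Fin K → ℕ → Ω → Prop := fun i s ω => i ∈ elimUCB L T tie (fun t => x t ω) s with hp
  set p' : Fin K → ℕ → Ω → Prop := fun i s ω =>
    i ∈ elimUCB L T tie (fun t => x t ω) s ∧ i = arm K s with hp'
  have hmem : ∀ (q : ℕ → Ω → Prop) (i : Fin K) (A : Finset ℕ) (ω : Ω), ∀ t < T,
      (∀ s, s ∈ A ↔ s ∈ Finset.Ico 1 (t + 1) ∧ q s ω) →
      √3 / 2 * radius T A.card * A.card ≤ |∑ s ∈ A, (x s ω i - μ s i)| → ω ∈ B q i A.card := by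
    intro q i A ω t ht hA h
    have hA' : ((Finset.Ico 1 (t + 1)).filter fun r => q r ω) = A := by
      ext s
      rw [Finset.mem_filter, hA]
    exact ⟨t + 1, ht, by rw [hA'], by rwa [hA']⟩
  -- The union runs over arms, sample sizes and both kinds of samples, for a total of `K * T * (4 /
  -- T ^ 3)`.
  have hsub : {ω | ¬ Concentrated T (fun t => x t ω) μ (elimUCB L T tie fun t => x t ω)}
      ⊆ ⋃ i, ⋃ n ∈ Finset.Icc 1 T, (B (p i) i n ∪ B (p' i) i n) := by
    intro ω hω
    by_contra hnot
    refine hω ⟨fun t ht i hne => ?_, fun t ht i hne => ?_⟩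
    all_goals
      by_contra hlt
      refine hnot (Set.mem_iUnion.2 ⟨i, Set.mem_iUnion₂.2 ⟨_, Finset.mem_Icc.2 ⟨Finset.card_pos.2
        (Finset.nonempty_iff_ne_empty.2 hne), ?_⟩, ?_⟩⟩)
      · refine (Finset.card_filter_le _ _).trans ?_
        rw [Nat.card_Ico]
        omega
    · exact Or.inl (hmem _ i _ ω t ht (fun s => Finset.mem_filter)
        (le_abs_sum_of_lt_abs_empMean hne (not_le.1 hlt)))
    · exact Or.inr (hmem _ i _ ω t ht (fun s => Finset.mem_filter)
        (le_abs_sum_of_lt_abs_empMean hne (not_le.1 hlt)))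
  have hBn : ∀ i, ∀ n ∈ Finset.Icc 1 T, P (B (p i) i n ∪ B (p' i) i n)
      ≤ ENNReal.ofReal (4 / T ^ 3) := by
    intro i n hn
    have hn1 := (Finset.mem_Icc.1 hn).1
    have h1 := measure_radius_le_abs_sum_le henv i (p := p i) hT hn1
      (measurableSet_sampling L T tie x (fun _ A => i ∈ A) n)
    have h2 := measure_radius_le_abs_sum_le henv i (p := p' i) hT hn1
      (measurableSet_sampling L T tie x (fun s A => i ∈ A ∧ i = arm K s) n)
    refine (measure_union_le _ _).trans ((add_le_add h1 h2).trans (le_of_eq ?_))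
    rw [← ENNReal.ofReal_add (by positivity) (by positivity)]
    congr 1
    ring
  refine (measure_mono hsub).trans ((measure_iUnion_fintype_le _ _).trans ?_)
  refine (Finset.sum_le_sum fun i _ => (measure_biUnion_finset_le _ _).trans
    (Finset.sum_le_sum (hBn i))).trans (le_of_eq ?_)
  rw [Finset.sum_const, Finset.sum_const, Nat.card_Icc, Finset.card_univ, Fintype.card_fin,
    ← ENNReal.ofReal_nsmul, ← ENNReal.ofReal_nsmul]
  congr 1
  simp only [nsmul_eq_mul, Nat.add_sub_cancel]
  field_simp

theorem integrable_Reg (hL : 1 ≤ L) (hLK : L ≤ K) (henv : IsEnvironment P x μ) (S : ℕ) :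
    Integrable (fun ω => Reg L μ (elimUCB L T tie fun t => x t ω) S) P := by
  refine Integrable.of_bound (C := L * S) (Measurable.aestronglyMeasurable ?_)
    (Eventually.of_forall fun ω => ?_)
  · intro B _
    refine measurableSet_elimUCB L T tie (t := S) (fun s _ => henv.measurable s)
      (q := fun I => Reg L μ I S ∈ B) fun I I' h => ?_
    have : Reg L μ I S = Reg L μ I' S := Finset.sum_congr rfl fun t ht => by
      rw [reg, reg, h t (Finset.mem_Icc.1 ht).2]
    rw [this]
  · exact abs_Reg_le hL hLK henv.mean_mem_Icc S

theorem integral_Reg_le (hL : 1 ≤ L) {m : Fin K → ℝ} (henv : IsEnvironment P x fun _ => m)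
    {A : Finset (Fin K)} (hA : A.card = L) {d : ℝ} (hd : 0 < d)
    (hgap : ∀ j ∈ A, ∀ i ∉ A, d ≤ m j - m i) :
    ∫ ω, Reg L (fun _ => m) (elimUCB L T tie fun t => x t ω) T ∂P
      ≤ 224 * (K * Real.log T / d) + 4 * K * L := by
  have hLK : L ≤ K := by simpa [hA] using Finset.card_le_univ A
  have hint := integrable_Reg L T tie hL hLK henv T
  have hlog := log_natCast_nonneg T
  have hK1 : (1 : ℝ) ≤ K := by exact_mod_cast NeZero.pos K
  have hL1 : (1 : ℝ) ≤ L := by exact_mod_cast hL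
  have hbound : ∀ ω, Reg L (fun _ => m) (elimUCB L T tie fun t => x t ω) T ≤ L * T := fun ω =>
    (le_abs_self _).trans (abs_Reg_le hL hLK henv.mean_mem_Icc T)
  rcases lt_or_ge T 2 with hT | hT
  · have h1 := integral_mono hint (integrable_const ((L : ℝ) * T)) hbound
    rw [integral_const, probReal_univ, one_smul] at h1
    have h2 : (T : ℝ) ≤ 1 := by exact_mod_cast Nat.le_of_lt_succ hT
    have h3 : 0 ≤ 224 * (K * Real.log T / d) := by positivity
    nlinarith [mul_nonneg (by linarith : (0 : ℝ) ≤ K - 1) (by linarith : (0 : ℝ) ≤ L)]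
  -- The measurable hull has the same measure, so measurability of the failure event itself is not
  -- needed.
  · set Z := toMeasurable P
      {ω | ¬ Concentrated T (fun t => x t ω) (fun _ => m) (elimUCB L T tie fun t => x t ω)} with hZ
    have hZm : MeasurableSet Z := measurableSet_toMeasurable _ _
    have hT' : (0 : ℝ) < T := by exact_mod_cast (by omega : 0 < T)
    have hZP : P.real Z ≤ 4 * K / T ^ 2 := by
      rw [measureReal_def, hZ, measure_toMeasurable]
      exact ENNReal.toReal_le_of_le_ofReal (by positivity)
        (measure_not_concentrated_le L T tie henv (by omega))
    have hpt : ∀ ω, Reg L (fun _ => m) (elimUCB L T tie fun t => x t ω) T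
        ≤ 224 * (K * Real.log T / d) + Z.indicator (fun _ => (L : ℝ) * T) ω := by
      intro ω
      by_cases hω : ω ∈ Z
      · rw [Set.indicator_of_mem hω]
        have h3 : 0 ≤ 224 * (K * Real.log T / d) := by positivity
        linarith [hbound ω]
      · rw [Set.indicator_of_notMem hω, add_zero]
        have hc := not_not.1 fun h => hω (subset_toMeasurable P _ h)
        exact Reg_le_of_concentrated_of_gap hL hT (henv.mean_mem_Icc 0) hA hd hgap hc
    have hind : Integrable (Z.indicator fun _ => (L : ℝ) * T) P :=
      (integrable_const _).indicator hZm
    have h1 := integral_mono hint ((integrable_const _).add hind) hpt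
    rw [integral_add' (integrable_const _) hind, integral_const, probReal_univ, one_smul,
      integral_indicator_const _ hZm, smul_eq_mul] at h1
    refine h1.trans (add_le_add le_rfl ?_)
    calc P.real Z * (L * T) ≤ 4 * K / T ^ 2 * (L * T) := by gcongr
      _ = 4 * K * L / T := by field_simp
      _ ≤ 4 * K * L := div_le_self (by positivity) (by exact_mod_cast (by omega : 1 ≤ T))

end Probability

end ElimUCB

/-! ### The main theorem -/

theorem mainTheorem4 :
    -- (A) monitoring consistency, for every realization of the rewards: for the base algorithm over
    -- the whole horizon, and for the adaptive resetting bandit between resets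
    (∀ (K : ℕ) [NeZero K] (L T : ℕ), 1 ≤ L → L ≤ K →
      ∀ (tie : ElimUCB.TieRule K) (x : ℕ → Fin K → ℝ),
        ElimUCB.MonitoringConsistent K T (ElimUCB.elimUCB L T tie x) ∧
        ∀ δ : ℝ, 0 < δ → δ < 1 → ∀ t < T,
          ElimUCB.MonitoringConsistentOn K (ElimUCB.adrWindowStart L T tie x δ t) (t + 1)
            (ElimUCB.adrElimUCB L T tie x δ)) ∧
    -- (B) logarithmic distribution-dependent regret in stationary environments
    (∃ C : ℝ, 0 < C ∧ ∀ (K : ℕ) [NeZero K] (L : ℕ) (hL : 1 ≤ L) (hLK : L < K) (μ : Fin K → ℝ)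
      (σ : Equiv.Perm (Fin K)), Antitone (μ ∘ σ) →
      0 < μ (σ ⟨L - 1, by omega⟩) - μ (σ ⟨L, hLK⟩) →
      ∃ r : ℕ → ℝ, (r =o[atTop] fun T : ℕ => Real.log T) ∧
        ∀ (T : ℕ) (Ω : Type*) [MeasurableSpace Ω] (P : Measure Ω) [IsProbabilityMeasure P]
          (x : ℕ → Ω → Fin K → ℝ), ElimUCB.IsEnvironment P x (fun _ => μ) →
          ∀ tie : ElimUCB.TieRule K,
            Integrable (fun ω => ElimUCB.Reg L (fun _ => μ)
              (ElimUCB.elimUCB L T tie (fun t => x t ω)) T) P ∧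
            ∫ ω, ElimUCB.Reg L (fun _ => μ) (ElimUCB.elimUCB L T tie (fun t => x t ω)) T ∂P
              ≤ C * (K * Real.log T / (μ (σ ⟨L - 1, by omega⟩) - μ (σ ⟨L, hLK⟩))) + r T) ∧
    -- (C) sublinear strong drift-tolerant regret in arbitrary environments
    (∃ (C : ℝ) (p : ℕ), 0 < C ∧ ∀ (K : ℕ) [NeZero K] (L T : ℕ), 1 ≤ L → L ≤ K → 1 ≤ T →
      ∀ (Ω : Type*) [MeasurableSpace Ω] (P : Measure Ω) [IsProbabilityMeasure P]
        (x : ℕ → Ω → Fin K → ℝ) (μ : ℕ → Fin K → ℝ), ElimUCB.IsEnvironment P x μ →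
        ∀ tie : ElimUCB.TieRule K,
          1 - 4 * (K : ℝ) / (T : ℝ) ^ 2 ≤ P.real {ω | ∀ S ∈ Finset.Icc 1 T,
            ElimUCB.Reg L μ (ElimUCB.elimUCB L T tie (fun t => x t ω)) S
              ≤ C * Real.log T ^ p * √((L : ℝ) * K * S)
                + C * L * ∑ t ∈ Finset.Icc 1 S, ElimUCB.drift μ t}) := by
  refine ⟨fun K _ L T _ _ tie x => ⟨ElimUCB.monitoringConsistent_elimUCB L T tie x,
      fun δ _ _ t _ => ElimUCB.monitoringConsistentOn_selection L T tie _ x t⟩,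
    ⟨224, by norm_num, fun K _ L hL hLK μ σ hσ hgap => ⟨fun _ => 4 * K * L, ?_,
      fun T Ω _ P _ x henv tie =>
        ⟨ElimUCB.integrable_Reg L T tie hL hLK.le henv T, ?_⟩⟩⟩,
    ⟨102, 1, by norm_num, fun K _ L T hL hLK hT Ω _ P _ x μ henv tie => ?_⟩⟩
  · exact isLittleO_const_left.2 (Or.inr (tendsto_abs_atTop_atTop.comp
      (Real.tendsto_log_atTop.comp tendsto_natCast_atTop_atTop)))
  -- `A` consists of the `L` best arms in the order `σ`; each exceeds every other arm by at least
  -- the gap between ranks `L` and `L + 1`.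
  · refine ElimUCB.integral_Reg_le L T tie hL henv
      (A := (Finset.univ.filter fun a : Fin K => (a : ℕ) < L).map σ.toEmbedding) ?_ hgap ?_
    · rw [Finset.card_map, Fin.card_filter_val_lt, min_eq_right hLK.le]
    · simp only [Finset.mem_map, Finset.mem_filter, Finset.mem_univ, true_and]
      rintro _ ⟨a, ha, rfl⟩ i hi
      obtain ⟨b, rfl⟩ := σ.surjective i
      have hb : L ≤ (b : ℕ) := by
        by_contra hb
        exact hi ⟨b, not_le.1 hb, rfl⟩
      have h1 := hσ (show a ≤ ⟨L - 1, by omega⟩ from Fin.mk_le_mk.2 (by omega))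
      have h2 := hσ (show ⟨L, hLK⟩ ≤ b from Fin.mk_le_mk.2 hb)
      exact sub_le_sub h1 h2
  · have hT' : (0 : ℝ) < T := by exact_mod_cast hT
    rcases lt_or_ge T 2 with hT2 | hT2
    · have hK1 : (1 : ℝ) ≤ K := by exact_mod_cast NeZero.pos K
      obtain rfl : T = 1 := by omega
      -- For `T = 1` the claimed lower bound `1 - 4 * K` is negative.
      refine le_trans ?_ measureReal_nonneg
      norm_num
      linarith
    · set G := {ω | ∀ S ∈ Finset.Icc 1 T,
        ElimUCB.Reg L μ (ElimUCB.elimUCB L T tie (fun t => x t ω)) S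
          ≤ 102 * Real.log T ^ 1 * √((L : ℝ) * K * S)
            + 102 * L * ∑ t ∈ Finset.Icc 1 S, ElimUCB.drift μ t} with hG
      have h1 : P.real Gᶜ ≤ 4 * K / T ^ 2 := by
        refine ENNReal.toReal_le_of_le_ofReal (by positivity)
          ((measure_mono fun ω hω => ?_).trans
            (ElimUCB.measure_not_concentrated_le L T tie henv hT))
        exact fun hc => hω fun S hS => ElimUCB.Reg_le_of_concentrated hL hLK hT2
          henv.mean_mem_Icc hc (Finset.mem_Icc.1 hS).2
      -- Subadditivity suffices, so `G` need not be measurable.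
      have h2 := measureReal_union_le (μ := P) G Gᶜ
      rw [Set.union_compl_self, probReal_univ] at h2
      linarith
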